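/- Let $0<q<1$, let $\gamma\ge 0$ be real, let $1<p<\infty$ and $p'=p/(p-1)$. For real $x$ put $[x]_q=\frac{1-q^x}{1-q}$, let $[k]_q!=[1]_q[2]_q\cdots[k]_q$, and let $\Gamma_q(t)=\frac{(q,q)_\infty}{(q^t,q)_\infty}(1-q)^{1-t}$ with $(x,q)_\infty=\prod_{j\ge0}(1-xq^j)$ be the $q$-gamma function (with $1/\Gamma_q(t)=0$ at the poles $t=0,-1,-2,\dots$). All sequences and matrices are complex and indexed by $\mathbb Z_0^+=\{0,1,2,\dots\}$. The fractional $q$-difference operator is $$(\nabla^{(\gamma)}_q g)_j=\sum_{k=0}^{j}(-1)^{j-k}q^{\binom{j-k}{2}}\frac{\Gamma_q(\gamma+1)}{[j-k]_q!\,\Gamma_q(\gamma-j+k+1)}\,g_k ,$$ and for a sequence space $\mathfrak X$ we put $\mathfrak X(\nabla^{(\gamma)}_q)=\{g:\nabla^{(\gamma)}_q g\in\mathfrak X\}$. For sets of sequences $\mathfrak X,\mathfrak Y$, an infinite matrix $\Phi=(\phi_{jk})$ belongs to $(\mathfrak X,\mathfrak Y)$ if for every $g\in\mathfrak X$ all the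 series $(\Phi g)_j=\sum_{k=0}^\infty\phi_{jk}g_k$ converge and $\Phi g\in\mathfrak Y$. For an infinite matrix $\Phi$ and $j,k,m\in\mathbb Z_0^+$ let $$\psi^{(j)}_{mk}=\sum_{v=k}^{m}\frac{[\gamma]_q[\gamma+1]_q\cdots[\gamma+v-k-1]_q}{[v-k]_q!}\,\phi_{jv}\ \ (k\le m),\qquad \psi^{(j)}_{mk}=0\ \ (k>m),\qquad \psi_{jk}=\lim_{m\to\infty}\psi^{(j)}_{mk}.$$ (The coefficients are those of the inverse of $\nabla^{(\gamma)}_q$.) Let $J$ range over the finite subsets of $\mathbb Z_0^+$. Consider the following conditions, where equalities between sums in (3) and (9) include that both sides are finite. 1. For each $j$: $\lim_m\psi^{(j)}_{mk}$ exists for all $k$, and $\sup_{m,k}|\psi^{(j)}_{mk}|<\infty$. 2. For each $j$: $\lim_m\psi^{(j)}_{mk}$ exists for all $k$, and $\sup_m\sum_{k=0}^m|\psi^{(j)}_{mk}|^{p'}<\infty$. 3. For each $j$: $\lim_m\psi^{(j)}_{mk}$ exists for all $k$, and $\lim_m\sum_{k=0}^m|\psi^{(j)}_{mk}|=\sum_{k=0}^\infty|\psi_{jk}|$.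 4. $\sup_J\sum_{k=0}^\infty\bigl|\sum_{j\in J}\psi_{jk}\bigr|<\infty$. 5. $\lim_j\psi_{jk}=0$ for all $k$. 6. $\lim_j\psi_{jk}$ exists for all $k$. 7. $\sup_j\sum_{k=0}^\infty|\psi_{jk}|<\infty$. 8. $\lim_j\sum_{k=0}^\infty|\psi_{jk}|=0$. 9. $\lim_j\sum_{k=0}^\infty|\psi_{jk}|=\sum_{k=0}^\infty|\lim_j\psi_{jk}|$. 10. $\sup_j\sum_{k=0}^\infty|\psi_{jk}|^{p'}<\infty$. 11. $\sup_J\sup_k\bigl|\sum_{j\in J}\psi_{jk}\bigr|<\infty$. 12. $\sup_J\sum_{k=0}^\infty\bigl|\sum_{j\in J}\psi_{jk}\bigr|^{p'}<\infty$. 13. $\sup_{j,k}|\psi_{jk}|<\infty$. Then $\Phi\in(\mathfrak X,\mathfrak Y)$ if and only if the conditions in the corresponding entry of the following table all hold: $$\begin{array}{l|llll} \mathfrak X\ \backslash\ \mathfrak Y & \ell_1 & c_0 & c & \ell_\infty\\\hline \ell_1(\nabla^{(\gamma)}_q) & 1,11 & 1,5,13 & 1,6,13 & 1,13\\ \ell_p(\nabla^{(\gamma)}_q)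 & 2,12 & 2,5,10 & 2,6,10 & 2,10\\ \ell_\infty(\nabla^{(\gamma)}_q) & 3,4 & 3,8 & 3,6,9 & 3,7 \end{array}$$ (Every entry contains 1, 2 or 3, which ensures that the $\psi_{jk}$ exist.) -/

import Mathlib

open Filter Topology
open scoped ENNReal

noncomputable section

/-! ### Matrix classes between spaces of complex sequences -/

/-- Complex sequences indexed by the nonnegative integers. -/
abbrev CSeq : Type := ℕ → ℂ

/-- Infinite complex matrices; `A j k` is the entry in row `j` and column `k`. -/
abbrev CMat : Type := ℕ → ℕ → ℂ

/-- The sequence space `ℓ_p`, for `p` in `[0, ∞]`. -/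
def ellSpace (p : ℝ≥0∞) : Set CSeq := {g | Memℓp g p}

/-- The space `c` of convergent sequences. -/
def convSpace : Set CSeq := {g | ∃ a : ℂ, Tendsto g atTop (𝓝 a)}

/-- The space `c₀` of null sequences. -/
def nullSpace : Set CSeq := {g | Tendsto g atTop (𝓝 0)}

/-- The class `(X, Y)` of the infinite matrices `A` such that for every `g ∈ X` all the series
`(A g)_j = ∑ₖ A j k * g k` converge (as limits of their partial sums, not necessarily absolutely)
and the sequence `A g` lies in `Y`. -/
def matrixClass (X Y : Set CSeq) : Set CMat :=
  {A | ∀ g ∈ X, ∃ h ∈ Y, ∀ j,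
    Tendsto (fun n : ℕ => ∑ k ∈ Finset.range n, A j k * g k) atTop (𝓝 (h j))}

/-! ### The fractional `q`-difference operator -/

/-- The `q`-number `[x]_q = (1 - q ^ x) / (1 - q)`; for a natural number `x` it is
`1 + q + ⋯ + q ^ (x - 1)`. -/
def qNum (q x : ℝ) : ℝ := (1 - q ^ x) / (1 - q)

/-- The `q`-factorial `[n]_q! = [1]_q [2]_q ⋯ [n]_q`. -/
def qFact (q : ℝ) (n : ℕ) : ℝ := ∏ i ∈ Finset.range n, qNum q ((i : ℝ) + 1)

/-- The infinite product `(x, q)_∞ = ∏_{j ≥ 0} (1 - x q ^ j)`. -/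
def qPochInf (x q : ℝ) : ℝ := ∏' j : ℕ, (1 - x * q ^ j)

/-- The `q`-gamma function. At its poles `0, -1, -2, …` the denominator vanishes and the value is
`0` by convention, so that its reciprocal `(qGamma q t)⁻¹` has the correct value `0` there. -/
def qGamma (q t : ℝ) : ℝ := qPochInf q q / qPochInf (q ^ t) q * (1 - q) ^ (1 - t)

/-- The coefficient of `g_{j-k}` in `(∇_q^{(γ)} g)_j`. -/
def nablaCoeff (q γ : ℝ) (k : ℕ) : ℝ :=
  (-1) ^ k * q ^ (k.choose 2) * (qGamma q (γ + 1) / (qFact q k * qGamma q (γ - k + 1)))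

/-- The `q`-difference operator `∇_q^{(γ)}` of fractional order `γ`. -/
def nabla (q γ : ℝ) (g : CSeq) : CSeq := fun j =>
  ∑ k ∈ Finset.range (j + 1), (nablaCoeff q γ (j - k) : ℂ) * g k

/-- The domain `X(∇_q^{(γ)})` of the operator `∇_q^{(γ)}` in the sequence space `X`. -/
def nablaDomain (q γ : ℝ) (X : Set CSeq) : Set CSeq := {g | nabla q γ g ∈ X}

/-- The coefficient `[γ]_q [γ+1]_q ⋯ [γ+k-1]_q / [k]_q!` of `g_{j-k}` in the inverse operator
`(∇_q^{(-γ)} g)_j = g_j + [γ]_q g_{j-1} + [γ]_q [γ+1]_q / [2]_q! g_{j-2} + ⋯`. -/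
def nablaInvCoeff (q γ : ℝ) (k : ℕ) : ℝ :=
  (∏ i ∈ Finset.range k, qNum q (γ + i)) / qFact q k

/-! ### The associated matrices -/

/-- The triangle `Ψ^{(j)} = (ψ^{(j)}_{mk})_{m,k}`; the sum is empty, hence `0`, for `k > m`. -/
def psiRow (q γ : ℝ) (Φ : CMat) (j : ℕ) : CMat := fun m k =>
  ∑ v ∈ Finset.Icc k m, (nablaInvCoeff q γ (v - k) : ℂ) * Φ j v

/-- The matrix `Ψ = (ψ_{jk})`, where `ψ_{jk} = ∑_{v=k}^∞ …` is the limit of the partial sums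
`ψ^{(j)}_{mk}` as `m → ∞` (meaningful where that limit exists). -/
def psi (q γ : ℝ) (Φ : CMat) : CMat := fun j k =>
  limUnder atTop (fun m : ℕ => psiRow q γ Φ j m k)

/-! ### Conditions on a matrix -/

/-- `lim_j a_{jk}` exists for every `k`. -/
def ColLimitsExist (A : CMat) : Prop :=
  ∀ k, ∃ l : ℂ, Tendsto (fun j : ℕ => A j k) atTop (𝓝 l)

/-- `lim_j a_{jk} = 0` for every `k`. -/
def ColLimitsZero (A : CMat) : Prop :=
  ∀ k, Tendsto (fun j : ℕ => A j k) atTop (𝓝 0)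

/-- `sup_{j,k} |a_{jk}| < ∞`. -/
def EntriesBounded (A : CMat) : Prop := (⨆ (j : ℕ) (k : ℕ), ‖A j k‖ₑ) < ∞

/-- `sup_j ∑_k |a_{jk}| ^ s < ∞`. -/
def RowSumsBounded (s : ℝ) (A : CMat) : Prop := (⨆ j : ℕ, ∑' k, ‖A j k‖ₑ ^ s) < ∞

/-- `sup_m ∑_{k=0}^m |a_{mk}| ^ s < ∞`. -/
def PartialRowSumsBounded (s : ℝ) (A : CMat) : Prop :=
  (⨆ m : ℕ, ∑ k ∈ Finset.range (m + 1), ‖A m k‖ₑ ^ s) < ∞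

/-- `lim_j ∑_k |a_{jk}| = 0`. -/
def RowSumsTendToZero (A : CMat) : Prop :=
  Tendsto (fun j : ℕ => ∑' k, ‖A j k‖ₑ) atTop (𝓝 0)

/-- `lim_m ∑_{k=0}^m |a_{mk}| = ∑_k |b_k|`, the common value being finite. -/
def PartialRowSumsTendTo (A : CMat) (b : CSeq) : Prop :=
  (∑' k, ‖b k‖ₑ) < ∞ ∧
    Tendsto (fun m : ℕ => ∑ k ∈ Finset.range (m + 1), ‖A m k‖ₑ) atTop (𝓝 (∑' k, ‖b k‖ₑ))

/-- `lim_j ∑_k |a_{jk}| = ∑_k |lim_j a_{jk}|`, the common value being finite (meaningful where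
the limits `lim_j a_{jk}` exist). -/
def RowSumsTendToSumOfLimits (A : CMat) : Prop :=
  (∑' k, ‖limUnder atTop (fun j : ℕ => A j k)‖ₑ) < ∞ ∧
    Tendsto (fun j : ℕ => ∑' k, ‖A j k‖ₑ) atTop
      (𝓝 (∑' k, ‖limUnder atTop (fun j : ℕ => A j k)‖ₑ))

/-- `sup_J sup_k |∑_{j ∈ J} a_{jk}| < ∞`, over all finite sets `J` of indices. -/
def FiniteSumsBounded (A : CMat) : Prop :=
  (⨆ (J : Finset ℕ) (k : ℕ), ‖∑ j ∈ J, A j k‖ₑ) < ∞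

/-- `sup_J ∑_k |∑_{j ∈ J} a_{jk}| ^ s < ∞`, over all finite sets `J` of indices. -/
def FiniteSumsRowBounded (s : ℝ) (A : CMat) : Prop :=
  (⨆ J : Finset ℕ, ∑' k, ‖∑ j ∈ J, A j k‖ₑ ^ s) < ∞

/-! ### The conditions on the triangles `Ψ^{(j)}` for the three kinds of domain -/

/-- For every `j`: `lim_m ψ^{(j)}_{mk}` exists for all `k`, and `sup_{m,k} |ψ^{(j)}_{mk}| < ∞`. -/
def TrianglesOne (q γ : ℝ) (Φ : CMat) : Prop :=
  ∀ j, ColLimitsExist (psiRow q γ Φ j) ∧ EntriesBounded (psiRow q γ Φ j)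

/-- For every `j`: `lim_m ψ^{(j)}_{mk}` exists for all `k`, and
`sup_m ∑_{k=0}^m |ψ^{(j)}_{mk}| ^ s < ∞`. -/
def TrianglesPow (q γ s : ℝ) (Φ : CMat) : Prop :=
  ∀ j, ColLimitsExist (psiRow q γ Φ j) ∧ PartialRowSumsBounded s (psiRow q γ Φ j)

/-- For every `j`: `lim_m ψ^{(j)}_{mk}` exists for all `k`, and
`lim_m ∑_{k=0}^m |ψ^{(j)}_{mk}| = ∑_{k=0}^∞ |ψ_{jk}| < ∞`. -/
def TrianglesInfty (q γ : ℝ) (Φ : CMat) : Prop :=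
  ∀ j, ColLimitsExist (psiRow q γ Φ j) ∧
    PartialRowSumsTendTo (psiRow q γ Φ j) (psi q γ Φ j)

end

/-! ### The inverse of the fractional `q`-difference operator -/

/-! The operator is convolution with a sequence whose generating series `A` satisfies `(1 - q^γ X)
A(X) = (1 - X) A(qX)`. The series `B` of the proposed inverse satisfies the same equation with the
two linear factors exchanged. Hence `F = AB` satisfies `F(X) = F(qX)`, and `F = 1` because `q ^ n ≠
1` for `n > 0`. The operator is therefore a bijection of the space of all sequences.

Writing `g` as the inverse image of `h` and interchanging two finite sums turns the partial sums of
`(Φ g)_j` into the `j`-th triangle applied to `h`. Every triangle must then map `ℓ_p` into `c`. In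
that case its limit at `h` is `∑ₖ ψ_{jk} h_k`, so what remains is that `Ψ` maps `ℓ_p` into the
target (`mem_matrixClass_nablaDomain_iff`).

The rest is the classical description of matrix classes on `ℓ_p`. By Banach–Steinhaus
(`exists_rowBd`) the rows are uniformly bounded functionals, and Hölder duality expresses this as a
bound on sup norms, `ℓ_{p'}` norms or `ℓ_1` norms. For the target `ℓ_1` the same principle is
applied to all finite sums of rows. For `p < ∞` sections are dense, so limits need be checked only
on columns. For `p = ∞` density fails, and Schur's theorem (`tendsto_tsum_norm_of_weakly_null`)
replaces it. -/

theorem one_sub_rpow_ne_zero {q t : ℝ} (hq0 : 0 < q) (hq1 : q < 1) (ht : 0 < t) :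
    1 - q ^ t ≠ 0 :=
  (sub_pos.2 (Real.rpow_lt_one hq0.le hq1 ht)).ne'

theorem summable_norm_neg_mul_pow {q : ℝ} (hq0 : 0 < q) (hq1 : q < 1) (x : ℝ) :
    Summable fun j : ℕ => ‖-(x * q ^ j)‖ := by
  simpa [abs_of_pos hq0] using
    (summable_geometric_of_lt_one hq0.le hq1).mul_left |x|

theorem qPochInf_rpow {q : ℝ} (hq0 : 0 < q) (hq1 : q < 1) (t : ℝ) :
    qPochInf (q ^ t) q = (1 - q ^ t) * qPochInf (q ^ (t + 1)) q := by
  have hm : Multipliable fun j : ℕ => 1 + -(q ^ t * q ^ (j + 1)) := by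
    refine multipliable_one_add_of_summable ?_
    exact (summable_nat_add_iff 1).2 (summable_norm_neg_mul_pow hq0 hq1 (q ^ t))
  have h := tprod_eq_zero_mul' (f := fun j : ℕ => 1 - q ^ t * q ^ j)
    (by simpa only [sub_eq_add_neg] using hm)
  rw [qPochInf, h, qPochInf, Real.rpow_add_one hq0.ne']
  simp [pow_succ', mul_assoc]

theorem qPochInf_rpow_ne_zero {q t : ℝ} (hq0 : 0 < q) (hq1 : q < 1) (ht : 0 < t) :
    qPochInf (q ^ t) q ≠ 0 := by
  rw [qPochInf]
  simp only [sub_eq_add_neg]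
  refine tprod_one_add_ne_zero_of_summable (fun j => ?_)
    (summable_norm_neg_mul_pow hq0 hq1 (q ^ t))
  have := one_sub_rpow_ne_zero hq0 hq1 (t := t + j) (by positivity)
  rwa [Real.rpow_add_natCast hq0.ne', sub_eq_add_neg] at this

theorem qGamma_ne_zero {q t : ℝ} (hq0 : 0 < q) (hq1 : q < 1) (ht : 0 < t) : qGamma q t ≠ 0 := by
  have h1 := qPochInf_rpow_ne_zero hq0 hq1 one_pos
  rw [Real.rpow_one] at h1
  exact mul_ne_zero (div_ne_zero h1 (qPochInf_rpow_ne_zero hq0 hq1 ht))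
    (Real.rpow_pos_of_pos (sub_pos.2 hq1) _).ne'

/-- The functional equation of the `q`-gamma function, valid also at the poles. -/
theorem inv_qGamma {q : ℝ} (hq0 : 0 < q) (hq1 : q < 1) (t : ℝ) :
    (qGamma q t)⁻¹ = qNum q t * (qGamma q (t + 1))⁻¹ := by
  have h1 : (1 - q) ^ (1 - t) = (1 - q) * (1 - q) ^ (1 - (t + 1)) := by
    rw [show 1 - t = 1 - (t + 1) + 1 by ring, Real.rpow_add_one (sub_pos.2 hq1).ne', mul_comm]
  rw [qGamma, qGamma, qNum, h1, qPochInf_rpow hq0 hq1 t]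
  simp only [mul_inv, div_eq_mul_inv, inv_inv]
  ring

theorem qFact_succ (q : ℝ) (n : ℕ) : qFact q (n + 1) = qFact q n * qNum q ((n : ℝ) + 1) :=
  Finset.prod_range_succ _ _

theorem one_sub_pow_succ_ne_zero {q : ℝ} (hq0 : 0 < q) (hq1 : q < 1) (n : ℕ) :
    1 - q ^ (n + 1) ≠ 0 :=
  (sub_pos.2 (pow_lt_one₀ hq0.le hq1 n.succ_ne_zero)).ne'

theorem qNum_natCast_add_one (q : ℝ) (n : ℕ) :
    qNum q ((n : ℝ) + 1) = (1 - q ^ (n + 1)) / (1 - q) := by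
  rw [qNum, ← Nat.cast_succ, Real.rpow_natCast]

theorem nablaCoeff_zero {q γ : ℝ} (hq0 : 0 < q) (hq1 : q < 1) (hγ : 0 ≤ γ) :
    nablaCoeff q γ 0 = 1 := by
  have := qGamma_ne_zero hq0 hq1 (t := γ + 1) (by positivity)
  simp [nablaCoeff, qFact, this]

/-- The ratio of consecutive coefficients is `-q^k [γ-k]_q / [k+1]_q`, and `-q^k (1 - q^(γ-k)) = q^γ
- q^k`. The functional equation is used for reciprocals, so poles need no separate case. -/
theorem nablaCoeff_succ {q : ℝ} (hq0 : 0 < q) (hq1 : q < 1) (γ : ℝ) (k : ℕ) :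
    nablaCoeff q γ (k + 1) * (1 - q ^ (k + 1)) = nablaCoeff q γ k * (q ^ γ - q ^ k) := by
  have h1 := (sub_pos.2 hq1).ne'
  have h2 := one_sub_pow_succ_ne_zero hq0 hq1 k
  have h3 : q ^ γ = q ^ k * q ^ (γ - k) := by
    rw [← Real.rpow_natCast, ← Real.rpow_add hq0]; congr 1; ring
  have h4 := inv_qGamma hq0 hq1 (γ - k)
  have h5 : (k + 1).choose 2 = k + k.choose 2 := by simp [Nat.choose_succ_succ']
  rw [nablaCoeff, nablaCoeff, qFact_succ, qNum_natCast_add_one, Nat.cast_succ,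
    show γ - ((k : ℝ) + 1) + 1 = γ - k by ring, h5, h3, div_eq_mul_inv (qGamma q (γ + 1)),
    div_eq_mul_inv (qGamma q (γ + 1)), mul_inv, mul_inv, mul_inv, h4, qNum, pow_add q k]
  generalize (qGamma q (γ - k + 1))⁻¹ = G
  generalize (qFact q k)⁻¹ = F
  field_simp
  ring

theorem nablaInvCoeff_zero (q γ : ℝ) : nablaInvCoeff q γ 0 = 1 := by
  simp [nablaInvCoeff, qFact]

theorem nablaInvCoeff_succ {q : ℝ} (hq0 : 0 < q) (hq1 : q < 1) (γ : ℝ) (k : ℕ) :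
    nablaInvCoeff q γ (k + 1) * (1 - q ^ (k + 1)) =
      nablaInvCoeff q γ k * (1 - q ^ γ * q ^ k) := by
  have h1 := (sub_pos.2 hq1).ne'
  have h2 := one_sub_pow_succ_ne_zero hq0 hq1 k
  rw [nablaInvCoeff, nablaInvCoeff, qFact_succ, qNum_natCast_add_one, Finset.prod_range_succ,
    div_eq_mul_inv, div_eq_mul_inv, mul_inv, qNum, Real.rpow_add_natCast hq0.ne']
  field_simp

open PowerSeries in
/-- A recursion of order one for the coefficients, as a `q`-difference equation. -/
theorem mk_qRecursion {q u v : ℝ} {a : ℕ → ℝ}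
    (h : ∀ k, a (k + 1) * (1 - q ^ (k + 1)) = a k * (u - v * q ^ k)) :
    (1 - C u * X) * mk a = (1 - C v * X) * rescale q (mk a) := by
  ext n
  cases n with
  | zero =>
    have h0 : coeff 0 (rescale q (mk a)) = a 0 := by rw [coeff_rescale]; simp
    rw [coeff_zero_eq_constantCoeff_apply] at h0
    simp [sub_mul, mul_assoc, h0]
  | succ n =>
    simp only [sub_mul, one_mul, mul_assoc, map_sub, coeff_mk, coeff_C_mul, coeff_succ_X_mul,
      coeff_rescale]
    linear_combination h n

open PowerSeries in
theorem mk_nablaCoeff_mul_mk_nablaInvCoeff {q γ : ℝ} (hq0 : 0 < q) (hq1 : q < 1) (hγ : 0 ≤ γ) :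
    mk (nablaCoeff q γ) * mk (nablaInvCoeff q γ) = 1 := by
  have hA := mk_qRecursion (q := q) (u := q ^ γ) (v := 1) (a := nablaCoeff q γ)
    fun k => by rw [one_mul]; exact nablaCoeff_succ hq0 hq1 γ k
  have hB := mk_qRecursion (q := q) (u := 1) (v := q ^ γ) (a := nablaInvCoeff q γ)
    (nablaInvCoeff_succ hq0 hq1 γ)
  have hne (u : ℝ) : (1 - C u * X : PowerSeries ℝ) ≠ 0 := fun h => by
    simpa using congrArg (coeff 0) h
  set F := mk (nablaCoeff q γ) * mk (nablaInvCoeff q γ) with hF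
  -- Multiplying the two `q`-difference equations puts the same product of linear factors on both
  -- sides, and it cancels.
  have hres : F = rescale q F := by
    refine mul_left_cancel₀ (mul_ne_zero (hne (q ^ γ)) (hne 1)) ?_
    rw [hF, map_mul]
    linear_combination (1 - C 1 * X) * mk (nablaInvCoeff q γ) * hA +
      (1 - C 1 * X) * rescale q (mk (nablaCoeff q γ)) * hB
  ext n
  cases n with
  | zero => simp [hF, nablaCoeff_zero hq0 hq1 hγ, nablaInvCoeff_zero]
  | succ n =>
    have h := congrArg (coeff (n + 1)) hres
    rw [coeff_rescale] at h
    -- Invariance under `X ↦ qX` says that this coefficient equals `q ^ (n + 1)` times itself.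
    have h' : coeff (n + 1) F * (1 - q ^ (n + 1)) = 0 := by linear_combination h
    rw [(mul_eq_zero.1 h').resolve_right (one_sub_pow_succ_ne_zero hq0 hq1 n), coeff_one,
      if_neg n.succ_ne_zero]

/-- The operator `∇_q^{(-γ)}`. -/
noncomputable def nablaInv (q γ : ℝ) (h : CSeq) : CSeq := fun j =>
  ∑ k ∈ Finset.range (j + 1), (nablaInvCoeff q γ (j - k) : ℂ) * h k

theorem sum_range_mul_eq_coeff (a : ℕ → ℝ) (g : CSeq) (j : ℕ) :
    ∑ k ∈ Finset.range (j + 1), (a (j - k) : ℂ) * g k =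
      PowerSeries.coeff j
        (PowerSeries.mk g * PowerSeries.map Complex.ofRealHom (PowerSeries.mk a)) := by
  rw [PowerSeries.coeff_mul, Finset.Nat.sum_antidiagonal_eq_sum_range_succ_mk]
  exact Finset.sum_congr rfl fun k _ => by simp [mul_comm]

theorem mk_nabla (q γ : ℝ) (g : CSeq) : PowerSeries.mk (nabla q γ g) =
    PowerSeries.mk g * PowerSeries.map Complex.ofRealHom (PowerSeries.mk (nablaCoeff q γ)) := by
  ext j
  rw [PowerSeries.coeff_mk, nabla, sum_range_mul_eq_coeff]

theorem mk_nablaInv (q γ : ℝ) (g : CSeq) : PowerSeries.mk (nablaInv q γ g) =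
    PowerSeries.mk g *
      PowerSeries.map Complex.ofRealHom (PowerSeries.mk (nablaInvCoeff q γ)) := by
  ext j
  rw [PowerSeries.coeff_mk, nablaInv, sum_range_mul_eq_coeff]

theorem powerSeries_mk_injective {g h : CSeq} (H : PowerSeries.mk g = PowerSeries.mk h) :
    g = h := by
  funext j
  simpa using congrArg (PowerSeries.coeff j) H

theorem nabla_nablaInv {q γ : ℝ} (hq0 : 0 < q) (hq1 : q < 1) (hγ : 0 ≤ γ) (h : CSeq) :
    nabla q γ (nablaInv q γ h) = h := by
  apply powerSeries_mk_injective
  rw [mk_nabla, mk_nablaInv, mul_assoc, ← map_mul, mul_comm (PowerSeries.mk (nablaInvCoeff q γ)),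
    mk_nablaCoeff_mul_mk_nablaInvCoeff hq0 hq1 hγ, map_one, mul_one]

theorem nablaInv_nabla {q γ : ℝ} (hq0 : 0 < q) (hq1 : q < 1) (hγ : 0 ≤ γ) (g : CSeq) :
    nablaInv q γ (nabla q γ g) = g := by
  apply powerSeries_mk_injective
  rw [mk_nablaInv, mk_nabla, mul_assoc, ← map_mul,
    mk_nablaCoeff_mul_mk_nablaInvCoeff hq0 hq1 hγ, map_one, mul_one]

/-! ### Reduction to the triangles -/

theorem psiRow_of_lt {q γ : ℝ} {Φ : CMat} {j m k : ℕ} (h : m < k) : psiRow q γ Φ j m k = 0 := by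
  simp [psiRow, Finset.Icc_eq_empty_of_lt h]

theorem sum_mul_nablaInv (q γ : ℝ) (Φ : CMat) (h : CSeq) (j m : ℕ) :
    ∑ v ∈ Finset.range (m + 1), Φ j v * nablaInv q γ h v =
      ∑ k ∈ Finset.range (m + 1), psiRow q γ Φ j m k * h k := by
  simp only [nablaInv, psiRow, Finset.mul_sum, Finset.sum_mul]
  rw [Finset.sum_comm' (s' := fun k => Finset.Icc k m) (t' := Finset.range (m + 1))]
  · exact Finset.sum_congr rfl fun k _ => Finset.sum_congr rfl fun v _ => by ring
  · intro v k
    simp only [Finset.mem_range, Finset.mem_Icc]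
    omega

/-- Membership of `Φ` in a class over the domain of `∇_q^{(γ)}`, in terms of the triangles. -/
theorem mem_matrixClass_nablaDomain {q γ : ℝ} (hq0 : 0 < q) (hq1 : q < 1) (hγ : 0 ≤ γ)
    (Φ : CMat) (X Y : Set CSeq) :
    Φ ∈ matrixClass (nablaDomain q γ X) Y ↔ ∀ h ∈ X, ∃ y ∈ Y, ∀ j,
      Tendsto (fun m => ∑ k ∈ Finset.range (m + 1), psiRow q γ Φ j m k * h k) atTop
        (𝓝 (y j)) := by
  have key (h : CSeq) (j : ℕ) (a : ℂ) :
      Tendsto (fun n => ∑ k ∈ Finset.range n, Φ j k * nablaInv q γ h k) atTop (𝓝 a) ↔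
        Tendsto (fun m => ∑ k ∈ Finset.range (m + 1), psiRow q γ Φ j m k * h k) atTop (𝓝 a) := by
    simp only [← sum_mul_nablaInv]
    exact (tendsto_add_atTop_iff_nat
      (f := fun n => ∑ k ∈ Finset.range n, Φ j k * nablaInv q γ h k) 1).symm
  constructor
  · intro H h hh
    obtain ⟨y, hy, hlim⟩ := H (nablaInv q γ h)
      (show nabla q γ _ ∈ X by rwa [nabla_nablaInv hq0 hq1 hγ])
    exact ⟨y, hy, fun j => (key h j _).1 (hlim j)⟩
  · intro H g hg
    obtain ⟨y, hy, hlim⟩ := H (nabla q γ g) hg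
    refine ⟨y, hy, fun j => ?_⟩
    have := (key (nabla q γ g) j _).2 (hlim j)
    rwa [nablaInv_nabla hq0 hq1 hγ] at this

/-! ### Rows acting boundedly on `ℓ_p` -/

/-- The functional `g ↦ ∑ₖ a k * g k` is bounded by `C` on the sections of elements of `ℓ_p`. -/
def RowBd (p : ℝ≥0∞) (C : ℝ) (a : CSeq) : Prop :=
  ∀ (n : ℕ) (g : lp (fun _ : ℕ => ℂ) p), ‖∑ k ∈ Finset.range n, a k * g k‖ ≤ C * ‖g‖

theorem exists_phase (z : ℂ) : ∃ u : ℂ, ‖u‖ ≤ 1 ∧ u * z = (‖z‖ : ℂ) := by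
  -- For `z = 0` this quotient is `0`, hence only the bound `‖u‖ ≤ 1`.
  refine ⟨(starRingEnd ℂ) z / (‖z‖ : ℂ), ?_, ?_⟩
  · rw [norm_div, RCLike.norm_conj, Complex.norm_real, norm_norm]
    exact div_self_le_one _
  · rcases eq_or_ne z 0 with rfl | hz
    · simp
    · rw [div_mul_eq_mul_div, Complex.conj_mul', sq, mul_div_assoc, div_self, mul_one]
      exact_mod_cast norm_ne_zero_iff.2 hz

/-- The product of a sequence with a sequence bounded by `1`, in `ℓ_p`. -/
theorem exists_lp_mul {p : ℝ≥0∞} (hp : p ≠ 0) {u : CSeq} (hu : ∀ k, ‖u k‖ ≤ 1)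
    (g : lp (fun _ : ℕ => ℂ) p) :
    ∃ g' : lp (fun _ : ℕ => ℂ) p, (∀ k, g' k = u k * g k) ∧ ‖g'‖ ≤ ‖g‖ := by
  have h (k : ℕ) : ‖u k * g k‖ ≤ ‖g k‖ := by
    rw [norm_mul]; exact mul_le_of_le_one_left (norm_nonneg _) (hu k)
  exact ⟨⟨fun k => u k * g k, (lp.memℓp g).mono' h⟩, fun k => rfl, lp.norm_mono hp h⟩

/-- The section of length `n` of an element of `ℓ_p`. -/
theorem exists_lp_section {p : ℝ≥0∞} (hp : p ≠ 0) (n : ℕ) (g : lp (fun _ : ℕ => ℂ) p) :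
    ∃ g' : lp (fun _ : ℕ => ℂ) p, (∀ k, g' k = if k < n then g k else 0) ∧ ‖g'‖ ≤ ‖g‖ := by
  obtain ⟨g', h1, h2⟩ := exists_lp_mul hp (u := fun k => if k < n then 1 else 0)
    (fun k => by split_ifs <;> simp) g
  exact ⟨g', fun k => by simp [h1], h2⟩

/-- Multiplying `g` by phases makes all terms nonnegative without increasing its norm. -/
theorem RowBd.sum_norm_le {p : ℝ≥0∞} (hp : p ≠ 0) {C : ℝ} {a : CSeq} (h : RowBd p C a)
    (g : lp (fun _ : ℕ => ℂ) p) (hC : 0 ≤ C) (n : ℕ) :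
    ∑ k ∈ Finset.range n, ‖a k * g k‖ ≤ C * ‖g‖ := by
  choose u hu1 hu2 using fun k => exists_phase (a k * g k)
  obtain ⟨g', h1, h2⟩ := exists_lp_mul hp hu1 g
  have h3 : ∑ k ∈ Finset.range n, a k * g' k =
      ((∑ k ∈ Finset.range n, ‖a k * g k‖ : ℝ) : ℂ) := by
    rw [Complex.ofReal_sum]
    exact Finset.sum_congr rfl fun k _ => by rw [h1, ← hu2]; ring
  have h4 := h n g'
  rw [h3, Complex.norm_real, Real.norm_of_nonneg
    (Finset.sum_nonneg fun _ _ => norm_nonneg _)] at h4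
  exact h4.trans (mul_le_mul_of_nonneg_left h2 hC)

theorem RowBd.mono {p : ℝ≥0∞} {C C' : ℝ} {a : CSeq} (h : RowBd p C a) (hC : C ≤ C') :
    RowBd p C' a :=
  fun n g => (h n g).trans (mul_le_mul_of_nonneg_right hC (lp.norm_nonneg' g))

theorem RowBd.sub {p : ℝ≥0∞} {C D : ℝ} {a b : CSeq} (ha : RowBd p C a) (hb : RowBd p D b) :
    RowBd p (C + D) (fun k => a k - b k) := fun n g => by
  simp only [sub_mul, Finset.sum_sub_distrib, add_mul]
  exact (norm_sub_le _ _).trans (add_le_add (ha n g) (hb n g))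

/-- The bound tests finitely many entries at a time, so it survives entrywise limits. -/
theorem RowBd.of_tendsto {p : ℝ≥0∞} {C : ℝ} {A : CMat} {l : CSeq} (h : ∀ j, RowBd p C (A j))
    (hl : ∀ k, Tendsto (fun j => A j k) atTop (𝓝 (l k))) : RowBd p C l := fun n g =>
  le_of_tendsto (tendsto_finsetSum _ fun k _ => (hl k).mul_const (g k)).norm
    (Eventually.of_forall fun j => h j n g)

theorem RowBd.summable_norm {p : ℝ≥0∞} (hp : p ≠ 0) {C : ℝ} {a : CSeq} (h : RowBd p C a)
    (g : lp (fun _ : ℕ => ℂ) p) : Summable fun k => ‖a k * g k‖ :=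
  summable_of_sum_range_le (fun _ => norm_nonneg _)
    fun n => (h.mono (le_abs_self C)).sum_norm_le hp g (abs_nonneg C) n

theorem RowBd.summable {p : ℝ≥0∞} (hp : p ≠ 0) {C : ℝ} {a : CSeq} (h : RowBd p C a)
    (g : lp (fun _ : ℕ => ℂ) p) : Summable fun k => a k * g k :=
  (h.summable_norm hp g).of_norm

theorem RowBd.norm_tsum_le {p : ℝ≥0∞} (hp : p ≠ 0) {C : ℝ} {a : CSeq} (h : RowBd p C a)
    (g : lp (fun _ : ℕ => ℂ) p) : ‖∑' k, a k * g k‖ ≤ C * ‖g‖ :=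
  le_of_tendsto (h.summable hp g).hasSum.tendsto_sum_nat.norm
    (Eventually.of_forall fun n => h n g)

theorem RowBd.norm_tsum_sub_sum_le {p : ℝ≥0∞} [Fact (1 ≤ p)] (hp : p ≠ 0) {C : ℝ} {a : CSeq}
    (h : RowBd p C a) {g g' : lp (fun _ : ℕ => ℂ) p} {n : ℕ}
    (hg' : ∀ k, g' k = if k < n then g k else 0) :
    ‖∑' k, a k * g k - ∑ k ∈ Finset.range n, a k * g k‖ ≤ C * ‖g - g'‖ := by
  have h1 : ∑ k ∈ Finset.range n, a k * g k = ∑' k, a k * g' k := by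
    rw [tsum_eq_sum (s := Finset.range n) fun k hk => by
      rw [hg', if_neg (by simpa using hk), mul_zero]]
    exact Finset.sum_congr rfl fun k hk => by rw [hg', if_pos (by simpa using hk)]
  have h2 : ∑' k, a k * g k - ∑' k, a k * g' k = ∑' k, a k * (g - g') k := by
    rw [← (h.summable hp g).tsum_sub (h.summable hp g')]
    exact tsum_congr fun k => by rw [lp.coeFn_sub, Pi.sub_apply, mul_sub]
  rw [h1, h2]
  exact h.norm_tsum_le hp (g - g')

/-! ### Uniform boundedness and classes into `ℓ_∞` and `ℓ_1` -/

theorem ne_zero_of_one_le {p : ℝ≥0∞} [h : Fact (1 ≤ p)] : p ≠ 0 :=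
  (zero_lt_one.trans_le h.out).ne'

/-- Uniform boundedness for functionals given by convergent series. -/
theorem exists_rowBd {p : ℝ≥0∞} [Fact (1 ≤ p)] {ι : Type*} {A : ι → CSeq}
    {T : ι → lp (fun _ : ℕ => ℂ) p → ℂ}
    (hT : ∀ i g, Tendsto (fun n => ∑ k ∈ Finset.range n, A i k * g k) atTop (𝓝 (T i g)))
    (hb : ∀ g, ∃ C, ∀ i, ‖T i g‖ ≤ C) : ∃ C, ∀ i, RowBd p C (A i) := by
  let P (i : ι) (n : ℕ) : lp (fun _ : ℕ => ℂ) p →L[ℂ] ℂ :=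
    ∑ k ∈ Finset.range n, A i k • lp.evalCLM ℂ (fun _ : ℕ => ℂ) p k
  have hP (i : ι) (n : ℕ) (g : lp (fun _ : ℕ => ℂ) p) :
      P i n g = ∑ k ∈ Finset.range n, A i k * g k := by
    simp only [P, FunLike.coe_sum, Finset.sum_apply]
    rfl
  have hlim (i : ι) : Tendsto (fun n g => P i n g) atTop (𝓝 (T i)) :=
    tendsto_pi_nhds.2 fun g => by simpa only [hP] using hT i g
  -- Banach–Steinhaus enters twice: here for continuity of each pointwise limit, then for a bound
  -- uniform in `i`.
  let S (i : ι) : lp (fun _ : ℕ => ℂ) p →L[ℂ] ℂ := continuousLinearMapOfTendsto (P i) (hlim i)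
  have hS (i : ι) (g : lp (fun _ : ℕ => ℂ) p) : S i g = T i g := rfl
  obtain ⟨C, hC⟩ := banach_steinhaus (g := S) hb
  refine ⟨C, fun i n g => ?_⟩
  -- On a section the series is a finite sum, so the operator norm bound controls partial sums.
  obtain ⟨g', h1, h2⟩ := exists_lp_section ne_zero_of_one_le n g
  have h3 : T i g' = ∑ k ∈ Finset.range n, A i k * g k := by
    refine tendsto_nhds_unique (hT i g') (tendsto_atTop_of_eventually_const (i₀ := n) ?_)
    intro m hm
    rw [← Finset.sum_subset (Finset.range_mono hm) fun k _ hk => by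
      rw [h1, if_neg (by simpa using hk), mul_zero]]
    exact Finset.sum_congr rfl fun k hk => by rw [h1, if_pos (by simpa using hk)]
  rw [← h3, ← hS]
  exact ((S i).le_of_opNorm_le (hC i) g').trans
    (mul_le_mul_of_nonneg_left h2 ((norm_nonneg _).trans (hC i)))

theorem norm_le_of_mem_ellSpace_top {y : CSeq} (hy : y ∈ ellSpace ∞) : ∃ C, ∀ j, ‖y j‖ ≤ C := by
  obtain ⟨C, hC⟩ := memℓp_infty_iff.1 hy
  exact ⟨C, fun j => hC ⟨j, rfl⟩⟩

theorem mem_ellSpace_top_of_norm_le {y : CSeq} {C : ℝ} (h : ∀ j, ‖y j‖ ≤ C) : y ∈ ellSpace ∞ :=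
  memℓp_infty_iff.2 ⟨C, by rintro _ ⟨j, rfl⟩; exact h j⟩

/-- Matrix classes from `ℓ_p` into spaces of bounded sequences. -/
theorem mem_matrixClass_iff {p : ℝ≥0∞} [Fact (1 ≤ p)] {Y : Set CSeq} (hY : Y ⊆ ellSpace ∞)
    (A : CMat) : A ∈ matrixClass (ellSpace p) Y ↔ (∃ C, ∀ j, RowBd p C (A j)) ∧
      ∀ g : lp (fun _ : ℕ => ℂ) p, (fun j => ∑' k, A j k * g k) ∈ Y := by
  constructor
  · intro H
    choose T hTY hT using fun g : lp (fun _ : ℕ => ℂ) p => H g (lp.memℓp g)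
    have hB : ∃ C, ∀ j, RowBd p C (A j) :=
      exists_rowBd (T := fun j g => T g j) (fun j g => hT g j)
        fun g => norm_le_of_mem_ellSpace_top (hY (hTY g))
    refine ⟨hB, fun g => ?_⟩
    obtain ⟨C, hC⟩ := hB
    have : (fun j => ∑' k, A j k * g k) = T g := funext fun j =>
      tendsto_nhds_unique ((hC j).summable ne_zero_of_one_le g).hasSum.tendsto_sum_nat (hT g j)
    rw [this]
    exact hTY g
  · rintro ⟨⟨C, hC⟩, H⟩ g hg
    exact ⟨_, H ⟨g, hg⟩, fun j =>
      ((hC j).summable ne_zero_of_one_le ⟨g, hg⟩).hasSum.tendsto_sum_nat⟩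

theorem convSpace_subset : convSpace ⊆ ellSpace ∞ := by
  rintro y ⟨a, ha⟩
  obtain ⟨C, hC⟩ := (Metric.isBounded_range_of_tendsto y ha).exists_norm_le
  exact mem_ellSpace_top_of_norm_le fun j => hC _ ⟨j, rfl⟩

theorem nullSpace_subset : nullSpace ⊆ ellSpace ∞ :=
  fun _ hy => convSpace_subset ⟨0, hy⟩

theorem ellSpace_one_subset : ellSpace 1 ⊆ ellSpace ∞ := fun _ hy =>
  Memℓp.of_exponent_ge hy le_top

theorem mem_ellSpace_one_iff {y : CSeq} : y ∈ ellSpace 1 ↔ Summable fun j => ‖y j‖ := by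
  rw [ellSpace, Set.mem_ofPred_eq, memℓp_gen_iff (by simp)]
  simp

theorem mem_matrixClass_top_iff {p : ℝ≥0∞} [Fact (1 ≤ p)] (A : CMat) :
    A ∈ matrixClass (ellSpace p) (ellSpace ∞) ↔ ∃ C, ∀ j, RowBd p C (A j) := by
  rw [mem_matrixClass_iff subset_rfl, and_iff_left_iff_imp]
  rintro ⟨C, hC⟩ g
  exact mem_ellSpace_top_of_norm_le fun j => (hC j).norm_tsum_le ne_zero_of_one_le g

/-- For real terms, split a finite set by sign; each half is a signed sum, whence `C + C`. Complex
terms reduce to real and imaginary parts. -/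
theorem summable_norm_of_norm_sum_le {f : CSeq} {C : ℝ} (h : ∀ J : Finset ℕ, ‖∑ j ∈ J, f j‖ ≤ C) :
    Summable fun j => ‖f j‖ := by
  have key (r : ℕ → ℝ) (hr : ∀ J : Finset ℕ, |∑ j ∈ J, r j| ≤ C) : Summable fun j => |r j| := by
    refine summable_of_sum_le (c := C + C) (fun _ => abs_nonneg _) fun J => ?_
    rw [← Finset.sum_filter_add_sum_filter_not J (fun j => 0 ≤ r j)]
    refine add_le_add ?_ ?_
    · rw [Finset.sum_congr rfl fun j hj => abs_of_nonneg (Finset.mem_filter.1 hj).2]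
      exact (le_abs_self _).trans (hr _)
    · rw [Finset.sum_congr rfl fun j hj => abs_of_neg (not_le.1 (Finset.mem_filter.1 hj).2),
        Finset.sum_neg_distrib]
      exact (neg_le_abs _).trans (hr _)
  have hre := key (fun j => (f j).re) fun J => by
    rw [← Complex.re_sum]; exact (Complex.abs_re_le_norm _).trans (h J)
  have him := key (fun j => (f j).im) fun J => by
    rw [← Complex.im_sum]; exact (Complex.abs_im_le_norm _).trans (h J)
  exact (hre.add him).of_nonneg_of_le (fun _ => norm_nonneg _)
    fun j => Complex.norm_le_abs_re_add_abs_im _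

/-- A sequence is absolutely summable exactly when its finite subsums are bounded, so uniform
boundedness is applied to the family of row sums indexed by `J`. -/
theorem mem_matrixClass_one_iff {p : ℝ≥0∞} [Fact (1 ≤ p)] (A : CMat) :
    A ∈ matrixClass (ellSpace p) (ellSpace 1) ↔
      ∃ C, ∀ J : Finset ℕ, RowBd p C (fun k => ∑ j ∈ J, A j k) := by
  have hp : p ≠ 0 := ne_zero_of_one_le
  rw [mem_matrixClass_iff ellSpace_one_subset]
  constructor
  · rintro ⟨⟨C, hC⟩, H⟩
    refine exists_rowBd (T := fun J g => ∑ j ∈ J, ∑' k, A j k * g k) (fun J g => ?_) fun g => ?_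
    · simp only [Finset.sum_mul]
      simp only [Finset.sum_comm (t := J)]
      exact tendsto_finsetSum _ fun j _ => ((hC j).summable hp g).hasSum.tendsto_sum_nat
    · have hs := mem_ellSpace_one_iff.1 (H g)
      exact ⟨_, fun J => (norm_sum_le _ _).trans (hs.sum_le_tsum J fun _ _ => norm_nonneg _)⟩
  · rintro ⟨C, hC⟩
    have hrow (j : ℕ) : RowBd p C (A j) := by simpa using hC {j}
    refine ⟨⟨C, hrow⟩, fun g => mem_ellSpace_one_iff.2 ?_⟩
    refine summable_norm_of_norm_sum_le (C := C * ‖g‖) fun J => ?_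
    rw [← Summable.tsum_finsetSum fun j _ => (hrow j).summable hp g]
    simpa only [Finset.sum_mul] using (hC J).norm_tsum_le hp g

/-! ### Limits of rows, for finite exponents -/

theorem exists_section_norm_sub_lt {p : ℝ≥0∞} [Fact (1 ≤ p)] (hp : p ≠ ∞)
    (g : lp (fun _ : ℕ => ℂ) p) {ε : ℝ} (hε : 0 < ε) :
    ∃ (n : ℕ) (g' : lp (fun _ : ℕ => ℂ) p), (∀ k, g' k = if k < n then g k else 0) ∧
      ‖g - g'‖ < ε := by
  have h := (lp.hasSum_single hp g).tendsto_sum_nat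
  obtain ⟨n, hn⟩ := (Metric.tendsto_atTop.1 h ε hε)
  refine ⟨n, ∑ i ∈ Finset.range n, lp.single p i (g i), fun k => ?_, ?_⟩
  · rw [lp.coeFn_sum, Finset.sum_apply]
    simp [Pi.single_apply]
  · rw [← dist_eq_norm, dist_comm]
    exact hn n le_rfl

/-- The tail of `g` has small norm and contributes little uniformly in `j`; the head involves
finitely many null columns. -/
theorem tendsto_tsum_zero_of_rowBd {p : ℝ≥0∞} [Fact (1 ≤ p)] (hp : p ≠ ∞) {C : ℝ} {A : CMat}
    (hA : ∀ j, RowBd p C (A j)) (hl : ColLimitsZero A) (g : lp (fun _ : ℕ => ℂ) p) :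
    Tendsto (fun j => ∑' k, A j k * g k) atTop (𝓝 0) := by
  rw [Metric.tendsto_nhds]
  intro ε hε
  -- The bound is enlarged to something strictly positive, to divide by it.
  have hC : 0 < |C| + 1 := by positivity
  obtain ⟨n, g', h1, h2⟩ := exists_section_norm_sub_lt hp g
    (show 0 < ε / 2 / (|C| + 1) by positivity)
  have h3 : Tendsto (fun j => ∑ k ∈ Finset.range n, A j k * g k) atTop (𝓝 0) := by
    simpa using tendsto_finsetSum (Finset.range n) fun k _ => (hl k).mul_const (g k)
  filter_upwards [Metric.tendsto_nhds.1 h3 (ε / 2) (by positivity)] with j hj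
  rw [dist_zero_right] at hj ⊢
  have h4 := (((hA j).mono (le_abs_self C)).mono (le_add_of_nonneg_right zero_le_one)
    ).norm_tsum_sub_sum_le ne_zero_of_one_le h1
  have h5 : (|C| + 1) * ‖g - g'‖ < ε / 2 := by
    rw [mul_comm]; exact (lt_div_iff₀ hC).1 h2
  have h6 := norm_sub_norm_le (∑' k, A j k * g k) (∑ k ∈ Finset.range n, A j k * g k)
  linarith

theorem tendsto_tsum_of_tendsto_tsum_sub {p : ℝ≥0∞} (hp : p ≠ 0) {C : ℝ} {A : CMat} {l : CSeq}
    (hA : ∀ j, RowBd p C (A j)) (hl : RowBd p C l) (g : lp (fun _ : ℕ => ℂ) p)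
    (h : Tendsto (fun j => ∑' k, (A j k - l k) * g k) atTop (𝓝 0)) :
    Tendsto (fun j => ∑' k, A j k * g k) atTop (𝓝 (∑' k, l k * g k)) := by
  have := h.add_const (∑' k, l k * g k)
  rw [zero_add] at this
  refine this.congr fun j => ?_
  simp only [sub_mul]
  rw [((hA j).summable hp g).tsum_sub (hl.summable hp g), sub_add_cancel]

theorem tendsto_tsum_of_rowBd {p : ℝ≥0∞} [Fact (1 ≤ p)] (hp : p ≠ ∞) {C : ℝ} {A : CMat}
    {l : CSeq} (hA : ∀ j, RowBd p C (A j))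
    (hl : ∀ k, Tendsto (fun j => A j k) atTop (𝓝 (l k))) (g : lp (fun _ : ℕ => ℂ) p) :
    Tendsto (fun j => ∑' k, A j k * g k) atTop (𝓝 (∑' k, l k * g k)) := by
  have hl' : RowBd p C l := RowBd.of_tendsto hA hl
  refine tendsto_tsum_of_tendsto_tsum_sub ne_zero_of_one_le hA hl' g ?_
  exact tendsto_tsum_zero_of_rowBd hp (A := fun j k => A j k - l k) (fun j => (hA j).sub hl')
    (fun k => by simpa using (hl k).sub_const (l k)) g

theorem tsum_mul_single {p : ℝ≥0∞} (a : CSeq) (k : ℕ) :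
    ∑' i, a i * (lp.single (E := fun _ : ℕ => ℂ) p k (1 : ℂ)) i = a k := by
  rw [tsum_eq_single k fun i hi => by rw [lp.single_apply_ne _ _ _ hi, mul_zero],
    lp.single_apply_self, mul_one]

theorem mem_matrixClass_null_iff {p : ℝ≥0∞} [Fact (1 ≤ p)] (hp : p ≠ ∞) (A : CMat) :
    A ∈ matrixClass (ellSpace p) nullSpace ↔
      ColLimitsZero A ∧ ∃ C, ∀ j, RowBd p C (A j) := by
  rw [mem_matrixClass_iff nullSpace_subset]
  constructor
  · rintro ⟨hB, H⟩
    exact ⟨fun k => by simpa only [tsum_mul_single] using! H (lp.single p k 1), hB⟩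
  · rintro ⟨h1, C, hC⟩
    exact ⟨⟨C, hC⟩, fun g => tendsto_tsum_zero_of_rowBd hp hC h1 g⟩

theorem mem_matrixClass_conv_iff {p : ℝ≥0∞} [Fact (1 ≤ p)] (hp : p ≠ ∞) (A : CMat) :
    A ∈ matrixClass (ellSpace p) convSpace ↔
      ColLimitsExist A ∧ ∃ C, ∀ j, RowBd p C (A j) := by
  rw [mem_matrixClass_iff convSpace_subset]
  constructor
  · rintro ⟨hB, H⟩
    exact ⟨fun k => by simpa only [tsum_mul_single] using! H (lp.single p k 1), hB⟩
  · rintro ⟨h1, C, hC⟩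
    choose l hl using h1
    exact ⟨⟨C, hC⟩, fun g => ⟨_, tendsto_tsum_of_rowBd hp hC hl g⟩⟩

/-! ### Limits of rows, for bounded sequences -/

theorem summable_mul_of_norm_le {a g : CSeq} (ha : Summable fun k => ‖a k‖) {C : ℝ}
    (hg : ∀ k, ‖g k‖ ≤ C) : Summable fun k => a k * g k :=
  Summable.of_norm_bounded (ha.mul_right C) fun k => by
    rw [norm_mul]; exact mul_le_mul_of_nonneg_left (hg k) (norm_nonneg _)

/-- In Schur's theorem the test sequence is prescribed on a finite set `I` and may be chosen as
phases elsewhere; replacing phases on `I` costs at most `2 ‖a k‖` per index. -/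
theorem tsum_norm_le_of_phases {a g : CSeq} {u : CSeq} (ha : Summable fun k => ‖a k‖)
    (hu : ∀ k, u k * a k = (‖a k‖ : ℂ)) (I : Finset ℕ) (hg : ∀ k, ‖g k‖ ≤ 1) :
    ∑' k, ‖a k‖ ≤ ‖∑' k, a k * (if k ∈ I then g k else u k)‖ + 2 * ∑ k ∈ I, ‖a k‖ := by
  have h1 (k : ℕ) : a k * (if k ∈ I then g k else u k) =
      (‖a k‖ : ℂ) + if k ∈ I then a k * g k - ‖a k‖ else 0 := by
    split_ifs
    · ring
    · rw [mul_comm, hu, add_zero]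
  have h2 : HasSum (fun k => if k ∈ I then a k * g k - (‖a k‖ : ℂ) else 0)
      (∑ k ∈ I, (a k * g k - ‖a k‖)) := by
    rw [← Finset.sum_congr rfl fun k (hk : k ∈ I) =>
      if_pos (c := k ∈ I) (t := a k * g k - (‖a k‖ : ℂ)) (e := 0) hk]
    exact hasSum_sum_of_ne_finset_zero fun k hk => if_neg hk
  have h3 : HasSum (fun k => (‖a k‖ : ℂ)) ((∑' k, ‖a k‖ : ℝ) : ℂ) :=
    Complex.hasSum_ofReal.2 ha.hasSum
  simp only [h1]
  rw [(h3.add h2).tsum_eq]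
  have h4 : ‖∑ k ∈ I, (a k * g k - ‖a k‖)‖ ≤ 2 * ∑ k ∈ I, ‖a k‖ := by
    rw [Finset.mul_sum]
    refine norm_sum_le_of_le _ fun k _ => (norm_sub_le _ _).trans ?_
    rw [norm_mul, Complex.norm_real, norm_norm, two_mul]
    exact add_le_add_left (mul_le_of_le_one_right (norm_nonneg _) (hg k)) _
  have h5 : ‖((∑' k, ‖a k‖ : ℝ) : ℂ)‖ = ∑' k, ‖a k‖ := by
    rw [Complex.norm_real, Real.norm_of_nonneg (tsum_nonneg fun _ => norm_nonneg _)]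
  have h6 := norm_le_add_norm_add ((∑' k, ‖a k‖ : ℝ) : ℂ) (∑ k ∈ I, (a k * g k - ‖a k‖))
  linarith

/-- Schur's theorem: weakly null sequences in `ℓ_1` are norm null. -/
theorem tendsto_tsum_norm_of_weakly_null {A : CMat} (hA : ∀ j, Summable fun k => ‖A j k‖)
    (h : ∀ g : CSeq, (∀ k, ‖g k‖ ≤ 1) → Tendsto (fun j => ∑' k, A j k * g k) atTop (𝓝 0)) :
    Tendsto (fun j => ∑' k, ‖A j k‖) atTop (𝓝 0) := by
  have hcol (k : ℕ) : Tendsto (fun j => A j k) atTop (𝓝 0) := by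
    refine (h (fun i => if i = k then 1 else 0) fun i => by split_ifs <;> simp).congr fun j => ?_
    rw [tsum_eq_single k fun i hi => by rw [if_neg hi, mul_zero], if_pos rfl, mul_one]
  rw [Metric.tendsto_nhds]
  intro ε hε
  -- In the product topology this ball is compact Hausdorff, hence Baire, and each row acts
  -- continuously on it.
  let K : Type := ℕ → Metric.closedBall (0 : ℂ) 1
  have hK (g : K) (k : ℕ) : ‖(g k : ℂ)‖ ≤ 1 :=
    mem_closedBall_zero_iff.1 (g k).2
  have hcont (j : ℕ) : Continuous fun g : K => ∑' k, A j k * (g k : ℂ) := by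
    refine continuous_tsum (fun k => ?_) (hA j) fun k g => ?_
    · exact continuous_const.mul (continuous_subtype_val.comp (continuous_apply k))
    · rw [norm_mul]; exact mul_le_of_le_one_right (norm_nonneg _) (hK g k)
  let F (N : ℕ) : Set K := {g | ∀ j, N ≤ j → ‖∑' k, A j k * (g k : ℂ)‖ ≤ ε / 4}
  have hF (N : ℕ) : IsClosed (F N) := by
    simp only [F, Set.ofPred_forall]
    exact isClosed_iInter fun j => isClosed_iInter fun _ =>
      isClosed_le (hcont j).norm continuous_const
  have hU : ⋃ N, F N = Set.univ := by
    refine Set.eq_univ_of_forall fun g => Set.mem_iUnion.2 ?_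
    obtain ⟨N, hN⟩ := Metric.tendsto_atTop.1 (h (fun k => g k) (hK g)) (ε / 4) (by positivity)
    exact ⟨N, fun j hj => by simpa using (hN j hj).le⟩
  have : CompactSpace (Metric.closedBall (0 : ℂ) 1) :=
    isCompact_iff_compactSpace.1 (isCompact_closedBall 0 1)
  have : Nonempty K := ⟨fun _ => ⟨0, by simp⟩⟩
  -- By Baire some `F N` has interior, and a basic open set inside it restricts only the coordinates
  -- in a finite set `I`.
  obtain ⟨N, g₀, hg₀⟩ := nonempty_interior_of_iUnion_of_closed hF hU
  obtain ⟨I, V, hV, hsub⟩ := isOpen_pi_iff.1 isOpen_interior g₀ hg₀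
  have hI : Tendsto (fun j => ∑ k ∈ I, ‖A j k‖) atTop (𝓝 0) := by
    simpa using tendsto_finsetSum I fun k _ => (hcol k).norm
  filter_upwards [eventually_ge_atTop N, Metric.tendsto_nhds.1 hI (ε / 4) (by positivity)]
    with j hj hj'
  choose u hu1 hu2 using fun k => exists_phase (A j k)
  -- This sequence depends on `j`, but membership in `F N` holds for all such choices. The final
  -- bound is `ε / 4 + 2 * (ε / 4) < ε`.
  let g : K := fun k => if k ∈ I then g₀ k else ⟨u k, by simpa using hu1 k⟩
  have hg : g ∈ F N := interior_subset (hsub fun k hk => by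
    simpa [g, if_pos (Finset.mem_coe.1 hk)] using (hV k hk).2)
  have h1 := hg j hj
  have h2 (k : ℕ) : (g k : ℂ) = if k ∈ I then (g₀ k : ℂ) else u k := by
    simp only [g]; split_ifs <;> rfl
  simp only [h2] at h1
  have h3 := tsum_norm_le_of_phases (hA j) hu2 I (hK g₀)
  rw [dist_zero_right, Real.norm_of_nonneg (Finset.sum_nonneg fun _ _ => norm_nonneg _)] at hj'
  rw [dist_zero_right, Real.norm_of_nonneg (tsum_nonneg fun _ => norm_nonneg _)]
  linarith

theorem norm_lp_one (f : lp (fun _ : ℕ => ℂ) 1) : ‖f‖ = ∑' k, ‖f k‖ := by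
  rw [lp.norm_eq_tsum_rpow (by simp)]
  simp

/-- Weakly Cauchy sequences in `ℓ_1` converge in norm. -/
theorem exists_tendsto_tsum_norm_sub {A : CMat} (hA : ∀ j, Summable fun k => ‖A j k‖)
    (h : ∀ g : CSeq, (∀ k, ‖g k‖ ≤ 1) → ∃ a, Tendsto (fun j => ∑' k, A j k * g k) atTop (𝓝 a)) :
    ∃ l : CSeq, (Summable fun k => ‖l k‖) ∧ (∀ k, Tendsto (fun j => A j k) atTop (𝓝 (l k))) ∧
      Tendsto (fun j => ∑' k, ‖A j k - l k‖) atTop (𝓝 0) := by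
  let F (j : ℕ) : lp (fun _ : ℕ => ℂ) 1 := ⟨A j, mem_ellSpace_one_iff.2 (hA j)⟩
  have hd (f f' : lp (fun _ : ℕ => ℂ) 1) : dist f f' = ∑' k, ‖f k - f' k‖ := by
    rw [dist_eq_norm, norm_lp_one]; rfl
  have hF : CauchySeq F := by
    rw [Metric.cauchySeq_iff]
    -- If the rows are not Cauchy, differences of norm at least `ε` can be chosen arbitrarily far
    -- out; these are weakly null, against Schur's theorem.
    by_contra! hcon
    obtain ⟨ε, hε, hcon⟩ := hcon
    choose m hm n hn hmn using hcon
    have hs (N : ℕ) : Summable fun k => ‖A (m N) k - A (n N) k‖ :=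
      ((hA (m N)).add (hA (n N))).of_nonneg_of_le (fun _ => norm_nonneg _)
        fun _ => norm_sub_le _ _
    have hlim := tendsto_tsum_norm_of_weakly_null (A := fun N k => A (m N) k - A (n N) k) hs
      fun g hg => by
        obtain ⟨a, ha⟩ := h g hg
        have := (ha.comp (tendsto_atTop_mono hm tendsto_id)).sub
          (ha.comp (tendsto_atTop_mono hn tendsto_id))
        rw [sub_self] at this
        refine this.congr fun N => ?_
        simp only [sub_mul, Function.comp_apply]
        rw [(summable_mul_of_norm_le (hA _) hg).tsum_sub (summable_mul_of_norm_le (hA _) hg)]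
    obtain ⟨N, hN⟩ := (hlim.eventually (gt_mem_nhds hε)).exists
    have := hmn N
    rw [hd] at this
    exact absurd hN (not_lt.2 this)
  obtain ⟨L, hL⟩ := cauchySeq_tendsto_of_complete hF
  refine ⟨L, mem_ellSpace_one_iff.1 (lp.memℓp L), fun k => ?_, ?_⟩
  · exact ((lp.lipschitzWith_one_eval (E := fun _ : ℕ => ℂ) 1 k).continuous.tendsto L).comp hL
  · simpa only [hd] using! tendsto_iff_dist_tendsto_zero.1 hL

theorem tendsto_tsum_norm_of_sub {A : CMat} {l : CSeq} (hA : ∀ j, Summable fun k => ‖A j k‖)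
    (hl : Summable fun k => ‖l k‖) (h : Tendsto (fun j => ∑' k, ‖A j k - l k‖) atTop (𝓝 0)) :
    Tendsto (fun j => ∑' k, ‖A j k‖) atTop (𝓝 (∑' k, ‖l k‖)) := by
  rw [tendsto_iff_dist_tendsto_zero]
  refine squeeze_zero (fun _ => dist_nonneg) (fun j => ?_) h
  have hs : Summable fun k => ‖A j k - l k‖ :=
    ((hA j).add hl).of_nonneg_of_le (fun _ => norm_nonneg _) fun _ => norm_sub_le _ _
  rw [dist_eq_norm, ← (hA j).tsum_sub hl]
  exact tsum_of_norm_bounded hs.hasSum fun k => abs_norm_sub_norm_le _ _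

/-- Pointwise convergence together with convergence of norms implies convergence in `ℓ_1`. -/
theorem tendsto_tsum_norm_sub {A : CMat} {l : CSeq} (hA : ∀ j, Summable fun k => ‖A j k‖)
    (hl : Summable fun k => ‖l k‖) (hcol : ∀ k, Tendsto (fun j => A j k) atTop (𝓝 (l k)))
    (h : Tendsto (fun j => ∑' k, ‖A j k‖) atTop (𝓝 (∑' k, ‖l k‖))) :
    Tendsto (fun j => ∑' k, ‖A j k - l k‖) atTop (𝓝 0) := by
  have hs (j : ℕ) : Summable fun k => ‖A j k - l k‖ :=
    ((hA j).add hl).of_nonneg_of_le (fun _ => norm_nonneg _) fun _ => norm_sub_le _ _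
  -- The summand lies between `0` and `2 ‖l k‖`, so dominated convergence applies although the rows
  -- themselves have no common majorant.
  have h1 : Tendsto (fun j => ∑' k, (‖A j k‖ + ‖l k‖ - ‖A j k - l k‖)) atTop
      (𝓝 (∑' k, (‖l k‖ + ‖l k‖ - ‖l k - l k‖))) := by
    refine tendsto_tsum_of_dominated_convergence (hl.add hl)
      (fun k => ((hcol k).norm.add_const _).sub ((hcol k).sub_const _).norm)
      (Eventually.of_forall fun j k => ?_)
    have h2 := norm_sub_le (A j k) (l k)
    have h3 := norm_sub_norm_le (A j k) (l k)
    rw [Real.norm_of_nonneg (by linarith)]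
    linarith
  have h2 := (h.add_const (∑' k, ‖l k‖)).sub h1
  simp only [sub_self, norm_zero, sub_zero] at h2
  rw [hl.tsum_add hl, sub_self] at h2
  refine h2.congr fun j => ?_
  rw [((hA j).add hl).tsum_sub (hs j), (hA j).tsum_add hl]
  ring

theorem tendsto_tsum_mul_of_tendsto_tsum_norm {A : CMat} (hA : ∀ j, Summable fun k => ‖A j k‖)
    (h : Tendsto (fun j => ∑' k, ‖A j k‖) atTop (𝓝 0)) (g : lp (fun _ : ℕ => ℂ) ∞) :
    Tendsto (fun j => ∑' k, A j k * g k) atTop (𝓝 0) := by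
  refine squeeze_zero_norm (fun j => ?_) (by simpa using h.mul_const ‖g‖)
  refine tsum_of_norm_bounded ((hA j).hasSum.mul_right ‖g‖) fun k => ?_
  rw [norm_mul]
  exact mul_le_mul_of_nonneg_left (lp.norm_apply_le_norm ENNReal.top_ne_zero g k) (norm_nonneg _)

theorem exists_lp_top {g : CSeq} {C : ℝ} (hg : ∀ k, ‖g k‖ ≤ C) :
    ∃ g' : lp (fun _ : ℕ => ℂ) ∞, ∀ k, g' k = g k :=
  ⟨⟨g, mem_ellSpace_top_of_norm_le hg⟩, fun _ => rfl⟩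

theorem RowBd.summable_norm_of_top {C : ℝ} {a : CSeq} (h : RowBd ∞ C a) :
    Summable fun k => ‖a k‖ := by
  obtain ⟨g, hg⟩ := exists_lp_top (g := fun _ => 1) (C := 1) fun k => by simp
  simpa [hg] using h.summable_norm ENNReal.top_ne_zero g

theorem rowBd_top_of_summable {a : CSeq} (h : Summable fun k => ‖a k‖) :
    RowBd ∞ (∑' k, ‖a k‖) a := fun n g => by
  refine (norm_sum_le _ _).trans ?_
  refine le_trans ?_ (mul_le_mul_of_nonneg_right
    (h.sum_le_tsum (Finset.range n) fun _ _ => norm_nonneg _) (norm_nonneg g))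
  rw [Finset.sum_mul]
  refine Finset.sum_le_sum fun k _ => ?_
  rw [norm_mul]
  exact mul_le_mul_of_nonneg_left (lp.norm_apply_le_norm ENNReal.top_ne_zero g k) (norm_nonneg _)

theorem exists_rowBd_top_of_tendsto {A : CMat} (hA : ∀ j, Summable fun k => ‖A j k‖) {x : ℝ}
    (h : Tendsto (fun j => ∑' k, ‖A j k‖) atTop (𝓝 x)) : ∃ C, ∀ j, RowBd ∞ C (A j) := by
  obtain ⟨C, hC⟩ := h.bddAbove_range
  exact ⟨C, fun j => (rowBd_top_of_summable (hA j)).mono (hC ⟨j, rfl⟩)⟩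

theorem mem_matrixClass_top_null_iff (A : CMat) :
    A ∈ matrixClass (ellSpace ∞) nullSpace ↔
      (∀ j, Summable fun k => ‖A j k‖) ∧ Tendsto (fun j => ∑' k, ‖A j k‖) atTop (𝓝 0) := by
  rw [mem_matrixClass_iff nullSpace_subset]
  constructor
  · rintro ⟨⟨C, hC⟩, H⟩
    have hA (j : ℕ) := (hC j).summable_norm_of_top
    refine ⟨hA, tendsto_tsum_norm_of_weakly_null hA fun g hg => ?_⟩
    obtain ⟨g', hg'⟩ := exists_lp_top hg
    simpa only [hg'] using! H g'
  · rintro ⟨hA, h⟩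
    exact ⟨exists_rowBd_top_of_tendsto hA h, tendsto_tsum_mul_of_tendsto_tsum_norm hA h⟩

/-- Mapping into `c` makes the rows weakly Cauchy, hence norm convergent. Conversely, convergence of
columns and of norms gives norm convergence. -/
theorem mem_matrixClass_top_conv_iff (A : CMat) :
    A ∈ matrixClass (ellSpace ∞) convSpace ↔
      (∀ j, Summable fun k => ‖A j k‖) ∧ ∃ l : CSeq, (Summable fun k => ‖l k‖) ∧
        (∀ k, Tendsto (fun j => A j k) atTop (𝓝 (l k))) ∧
        Tendsto (fun j => ∑' k, ‖A j k‖) atTop (𝓝 (∑' k, ‖l k‖)) := by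
  rw [mem_matrixClass_iff convSpace_subset]
  constructor
  · rintro ⟨⟨C, hC⟩, H⟩
    have hA (j : ℕ) := (hC j).summable_norm_of_top
    obtain ⟨l, hl, hcol, hlim⟩ := exists_tendsto_tsum_norm_sub hA fun g hg => by
      obtain ⟨g', hg'⟩ := exists_lp_top hg
      simpa only [hg'] using! H g'
    exact ⟨hA, l, hl, hcol, tendsto_tsum_norm_of_sub hA hl hlim⟩
  · rintro ⟨hA, l, hl, hcol, h⟩
    have hs (j : ℕ) : Summable fun k => ‖A j k - l k‖ :=
      ((hA j).add hl).of_nonneg_of_le (fun _ => norm_nonneg _) fun _ => norm_sub_le _ _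
    obtain ⟨C, hC⟩ := exists_rowBd_top_of_tendsto hA h
    exact ⟨⟨C, hC⟩, fun g => ⟨_, tendsto_tsum_of_tendsto_tsum_sub ENNReal.top_ne_zero hC
      (RowBd.of_tendsto hC hcol) g
      (tendsto_tsum_mul_of_tendsto_tsum_norm hs (tendsto_tsum_norm_sub hA hl hcol h) g)⟩⟩

/-- For a matrix mapping `ℓ_p` into `c`, the limits of the images are computed columnwise. -/
theorem tendsto_tsum_of_mem_matrixClass_conv {p : ℝ≥0∞} [Fact (1 ≤ p)] {A : CMat} {l : CSeq}
    (hA : A ∈ matrixClass (ellSpace p) convSpace)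
    (hl : ∀ k, Tendsto (fun j => A j k) atTop (𝓝 (l k))) (g : lp (fun _ : ℕ => ℂ) p) :
    Tendsto (fun j => ∑' k, A j k * g k) atTop (𝓝 (∑' k, l k * g k)) := by
  obtain ⟨C, hC⟩ := ((mem_matrixClass_iff convSpace_subset A).1 hA).1
  rcases eq_or_ne p ∞ with rfl | hp
  · obtain ⟨hs, l', hl', hcol, h⟩ := (mem_matrixClass_top_conv_iff A).1 hA
    obtain rfl : l = l' := funext fun k => tendsto_nhds_unique (hl k) (hcol k)
    have hs' (j : ℕ) : Summable fun k => ‖A j k - l k‖ :=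
      ((hs j).add hl').of_nonneg_of_le (fun _ => norm_nonneg _) fun _ => norm_sub_le _ _
    exact tendsto_tsum_of_tendsto_tsum_sub ENNReal.top_ne_zero hC (RowBd.of_tendsto hC hl) g
      (tendsto_tsum_mul_of_tendsto_tsum_norm hs' (tendsto_tsum_norm_sub hs hl' hcol h) g)
  · exact tendsto_tsum_of_rowBd hp hC hl g

/-! ### The norm of a row functional -/

theorem iSup_lt_top_iff_exists_ofReal {ι : Type*} {F : ι → ℝ≥0∞} :
    (⨆ i, F i) < ∞ ↔ ∃ C : ℝ, 0 ≤ C ∧ ∀ i, F i ≤ ENNReal.ofReal C := by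
  constructor
  · intro h
    refine ⟨(⨆ i, F i).toReal, ENNReal.toReal_nonneg, fun i => ?_⟩
    rw [ENNReal.ofReal_toReal h.ne]
    exact le_iSup F i
  · rintro ⟨C, -, hC⟩
    exact (iSup_le hC).trans_lt ENNReal.ofReal_lt_top

theorem enorm_rpow_eq_ofReal (z : ℂ) {s : ℝ} (hs : 0 ≤ s) :
    ‖z‖ₑ ^ s = ENNReal.ofReal (‖z‖ ^ s) := by
  rw [← ofReal_norm, ENNReal.ofReal_rpow_of_nonneg (norm_nonneg _) hs]

theorem RowBd.iSup_enorm_le {C : ℝ} {a : CSeq} (h : RowBd 1 C a) :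
    ⨆ k, ‖a k‖ₑ ≤ ENNReal.ofReal C := iSup_le fun k => by
  rw [← ofReal_norm]
  refine ENNReal.ofReal_le_ofReal ?_
  have h1 := h.norm_tsum_le one_ne_zero (lp.single 1 k 1)
  rwa [tsum_mul_single, lp.norm_single one_pos, norm_one, mul_one] at h1

theorem rowBd_one_of_iSup_enorm_le {C : ℝ} (hC : 0 ≤ C) {a : CSeq}
    (h : ⨆ k, ‖a k‖ₑ ≤ ENNReal.ofReal C) : RowBd 1 C a := fun n g => by
  have h1 (k : ℕ) : ‖a k‖ ≤ C := by
    rw [← ENNReal.ofReal_le_ofReal_iff hC, ofReal_norm]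
    exact (le_iSup (fun k => ‖a k‖ₑ) k).trans h
  have h2 : ∑ k ∈ Finset.range n, ‖g k‖ ≤ ‖g‖ := by
    simpa using lp.sum_rpow_le_norm_rpow (by simp) g (Finset.range n)
  refine (norm_sum_le _ _).trans (le_trans ?_ (mul_le_mul_of_nonneg_left h2 hC))
  rw [Finset.mul_sum]
  refine Finset.sum_le_sum fun k _ => ?_
  rw [norm_mul]
  exact mul_le_mul_of_nonneg_right (h1 k) (norm_nonneg _)

theorem RowBd.tsum_enorm_rpow_le {p s C : ℝ} (hps : p.HolderConjugate s) (hC : 0 ≤ C) {a : CSeq}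
    (h : RowBd (ENNReal.ofReal p) C a) : ∑' k, ‖a k‖ₑ ^ s ≤ ENNReal.ofReal (C ^ s) := by
  refine ENNReal.tsum_le_of_sum_range_le fun n => ?_
  have hs := hps.symm.pos
  have hp : (ENNReal.ofReal p).toReal = p := ENNReal.toReal_ofReal hps.nonneg
  simp only [enorm_rpow_eq_ofReal _ hs.le]
  rw [← ENNReal.ofReal_sum_of_nonneg fun k _ => by positivity]
  refine ENNReal.ofReal_le_ofReal ?_
  -- `G` is the extremal in Hölder's inequality; with the phases of `a` attached it is the test
  -- sequence `f`.
  obtain ⟨⟨G, hG1, hG2⟩, -⟩ := NNReal.isGreatest_Lp (Finset.range n) (fun k => ‖a k‖₊) hps.symm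
  choose u hu1 hu2 using fun k => exists_phase (a k)
  let f : CSeq := fun k => if k ∈ Finset.range n then u k * (G k : ℝ) else 0
  have hf0 (k : ℕ) (hk : k ∉ Finset.range n) : ‖f k‖ ^ p = 0 := by
    simp only [f, if_neg hk, norm_zero]
    exact Real.zero_rpow hps.ne_zero
  have hf : Memℓp f (ENNReal.ofReal p) := by
    refine memℓp_gen ?_
    rw [hp]
    exact summable_of_ne_finset_zero hf0
  have hfn : ‖(⟨f, hf⟩ : lp (fun _ : ℕ => ℂ) (ENNReal.ofReal p))‖ ≤ 1 := by
    refine lp.norm_le_of_tsum_le (hp.symm ▸ hps.pos) zero_le_one ?_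
    rw [Real.one_rpow, hp]
    change ∑' k, ‖f k‖ ^ p ≤ 1
    rw [tsum_eq_sum hf0]
    refine le_trans (Finset.sum_le_sum fun k hk => ?_)
      (show ∑ k ∈ Finset.range n, (G k : ℝ) ^ p ≤ 1 by exact_mod_cast hG1)
    refine Real.rpow_le_rpow (norm_nonneg _) ?_ hps.nonneg
    simp only [f, if_pos hk, norm_mul, Complex.norm_real, NNReal.norm_eq]
    exact mul_le_of_le_one_left (G k).2 (hu1 k)
  have h1 := (h n ⟨f, hf⟩).trans (mul_le_of_le_one_right hC hfn)
  have h2 : ∑ k ∈ Finset.range n, a k * f k =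
      ((∑ k ∈ Finset.range n, ‖a k‖ * G k : ℝ) : ℂ) := by
    rw [Complex.ofReal_sum]
    refine Finset.sum_congr rfl fun k hk => ?_
    simp only [f, if_pos hk, Complex.ofReal_mul, ← hu2]
    ring
  have h3 : ∑ k ∈ Finset.range n, ‖a k‖ * G k = (∑ k ∈ Finset.range n, ‖a k‖ ^ s) ^ (1 / s) := by
    have hG3 : ∑ k ∈ Finset.range n, ‖a k‖₊ * G k = _ := hG2
    simpa only [NNReal.coe_sum, NNReal.coe_mul, NNReal.coe_rpow, coe_nnnorm] using
      congrArg NNReal.toReal hG3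
  change ‖∑ k ∈ Finset.range n, a k * f k‖ ≤ C at h1
  rw [h2, Complex.norm_real, h3, Real.norm_of_nonneg (by positivity)] at h1
  rwa [one_div, Real.rpow_inv_le_iff_of_pos (by positivity) hC hs] at h1

theorem rowBd_of_tsum_enorm_rpow_le {p s D : ℝ} (hps : p.HolderConjugate s) (hD : 0 ≤ D)
    {a : CSeq} (h : ∑' k, ‖a k‖ₑ ^ s ≤ ENNReal.ofReal D) :
    RowBd (ENNReal.ofReal p) (D ^ (1 / s)) a := fun n g => by
  have hs := hps.symm.pos
  have hp : (ENNReal.ofReal p).toReal = p := ENNReal.toReal_ofReal hps.nonneg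
  have h1 : ∑ k ∈ Finset.range n, ‖a k‖ ^ s ≤ D := by
    have := (ENNReal.sum_le_tsum (Finset.range n)).trans h
    simp only [enorm_rpow_eq_ofReal _ hs.le] at this
    rwa [← ENNReal.ofReal_sum_of_nonneg fun k _ => by positivity,
      ENNReal.ofReal_le_ofReal_iff hD] at this
  have h2 : ∑ k ∈ Finset.range n, ‖g k‖ ^ p ≤ ‖g‖ ^ p := by
    have := lp.sum_rpow_le_norm_rpow (hp.symm ▸ hps.pos) g (Finset.range n)
    rwa [hp] at this
  have h3 : (∑ k ∈ Finset.range n, ‖g k‖ ^ p) ^ (1 / p) ≤ ‖g‖ := by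
    rw [one_div, Real.rpow_inv_le_iff_of_pos (by positivity) (lp.norm_nonneg' g) hps.pos]
    exact h2
  calc ‖∑ k ∈ Finset.range n, a k * g k‖
      ≤ ∑ k ∈ Finset.range n, ‖a k‖ * ‖g k‖ := norm_sum_le_of_le _ fun k _ => (norm_mul _ _).le
    _ ≤ (∑ k ∈ Finset.range n, ‖a k‖ ^ s) ^ (1 / s) *
          (∑ k ∈ Finset.range n, ‖g k‖ ^ p) ^ (1 / p) := by
        simpa only [abs_norm] using Real.inner_le_Lp_mul_Lq (Finset.range n) (fun k => ‖a k‖)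
          (fun k => ‖g k‖) hps.symm
    _ ≤ D ^ (1 / s) * ‖g‖ := by gcongr

theorem summable_norm_iff_tsum_enorm_lt_top {a : CSeq} :
    (Summable fun k => ‖a k‖) ↔ ∑' k, ‖a k‖ₑ < ∞ := by
  rw [lt_top_iff_ne_top]
  simp only [← ofReal_norm]
  constructor
  · intro h
    exact h.tsum_ofReal_ne_top
  · intro h
    exact (ENNReal.summable_toReal h).congr fun k => ENNReal.toReal_ofReal (norm_nonneg _)

theorem tsum_enorm_eq_ofReal {a : CSeq} (h : Summable fun k => ‖a k‖) :
    ∑' k, ‖a k‖ₑ = ENNReal.ofReal (∑' k, ‖a k‖) := by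
  rw [ENNReal.ofReal_tsum_of_nonneg (fun _ => norm_nonneg _) h]
  simp only [ofReal_norm]

theorem RowBd.tsum_enorm_le {C : ℝ} (hC : 0 ≤ C) {a : CSeq} (h : RowBd ∞ C a) :
    ∑' k, ‖a k‖ₑ ≤ ENNReal.ofReal C := by
  refine ENNReal.tsum_le_of_sum_range_le fun n => ?_
  simp only [← ofReal_norm]
  rw [← ENNReal.ofReal_sum_of_nonneg fun k _ => norm_nonneg _]
  refine ENNReal.ofReal_le_ofReal ?_
  obtain ⟨g, hg⟩ := exists_lp_top (g := fun _ => 1) (C := 1) fun k => by simp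
  have h1 : ‖g‖ ≤ 1 := lp.norm_le_of_forall_le zero_le_one fun k => by simp [hg]
  have h2 := h.sum_norm_le ENNReal.top_ne_zero g hC n
  simp only [hg, mul_one] at h2
  exact h2.trans (mul_le_of_le_one_right hC h1)

/-! ### Uniform row bounds as finite suprema -/

theorem exists_rowBd_one_iff {ι : Type*} (A : ι → CSeq) :
    (∃ C, ∀ i, RowBd 1 C (A i)) ↔ (⨆ (i : ι) (k : ℕ), ‖A i k‖ₑ) < ∞ := by
  rw [iSup_lt_top_iff_exists_ofReal]
  constructor
  · rintro ⟨C, hC⟩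
    exact ⟨|C|, abs_nonneg C, fun i => ((hC i).mono (le_abs_self C)).iSup_enorm_le⟩
  · rintro ⟨C, hC, h⟩
    exact ⟨C, fun i => rowBd_one_of_iSup_enorm_le hC (h i)⟩

theorem exists_rowBd_rpow_iff {p s : ℝ} (hps : p.HolderConjugate s) {ι : Type*} (A : ι → CSeq) :
    (∃ C, ∀ i, RowBd (ENNReal.ofReal p) C (A i)) ↔ (⨆ i, ∑' k, ‖A i k‖ₑ ^ s) < ∞ := by
  rw [iSup_lt_top_iff_exists_ofReal]
  constructor
  · rintro ⟨C, hC⟩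
    exact ⟨|C| ^ s, by positivity,
      fun i => ((hC i).mono (le_abs_self C)).tsum_enorm_rpow_le hps (abs_nonneg C)⟩
  · rintro ⟨D, hD, h⟩
    exact ⟨D ^ (1 / s), fun i => rowBd_of_tsum_enorm_rpow_le hps hD (h i)⟩

/-- The exponent `1` is kept so that the right side matches `RowSumsBounded 1` and
`FiniteSumsRowBounded 1`. -/
theorem exists_rowBd_top_iff {ι : Type*} (A : ι → CSeq) :
    (∃ C, ∀ i, RowBd ∞ C (A i)) ↔ (⨆ i, ∑' k, ‖A i k‖ₑ ^ (1 : ℝ)) < ∞ := by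
  simp only [ENNReal.rpow_one]
  rw [iSup_lt_top_iff_exists_ofReal]
  constructor
  · rintro ⟨C, hC⟩
    exact ⟨|C|, abs_nonneg C, fun i => ((hC i).mono (le_abs_self C)).tsum_enorm_le
      (abs_nonneg C)⟩
  · rintro ⟨D, hD, h⟩
    refine ⟨D, fun i => ?_⟩
    have hs := summable_norm_iff_tsum_enorm_lt_top.2 ((h i).trans_lt ENNReal.ofReal_lt_top)
    refine (rowBd_top_of_summable hs).mono ?_
    rw [← ENNReal.ofReal_le_ofReal_iff hD, ← tsum_enorm_eq_ofReal hs]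
    exact h i

/-! ### Matrix classes over the domain of the operator -/

theorem colLimitsExist_of_mem_matrixClass {p : ℝ≥0∞} [Fact (1 ≤ p)] {A : CMat}
    (hA : A ∈ matrixClass (ellSpace p) convSpace) : ColLimitsExist A := fun k => by
  simpa only [tsum_mul_single] using!
    ((mem_matrixClass_iff convSpace_subset A).1 hA).2 (lp.single p k 1)

theorem tendsto_psiRow {q γ : ℝ} {Φ : CMat} {j : ℕ} (h : ColLimitsExist (psiRow q γ Φ j))
    (k : ℕ) : Tendsto (fun m => psiRow q γ Φ j m k) atTop (𝓝 (psi q γ Φ j k)) :=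
  tendsto_nhds_limUnder (h k)

theorem tsum_psiRow_mul (q γ : ℝ) (Φ : CMat) (j m : ℕ) (g : CSeq) :
    ∑' k, psiRow q γ Φ j m k * g k =
      ∑ k ∈ Finset.range (m + 1), psiRow q γ Φ j m k * g k :=
  tsum_eq_sum fun k hk => by
    rw [psiRow_of_lt (by simpa [Nat.lt_succ_iff] using hk), zero_mul]

theorem psiRow_mem_matrixClass_iff {q γ : ℝ} {Φ : CMat} {j : ℕ} {X : Set CSeq} :
    psiRow q γ Φ j ∈ matrixClass X convSpace ↔ ∀ g ∈ X, ∃ a : ℂ,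
      Tendsto (fun m => ∑ k ∈ Finset.range (m + 1), psiRow q γ Φ j m k * g k) atTop (𝓝 a) := by
  have hrow (m : ℕ) (g : CSeq) :
      Tendsto (fun n => ∑ k ∈ Finset.range n, psiRow q γ Φ j m k * g k) atTop
        (𝓝 (∑ k ∈ Finset.range (m + 1), psiRow q γ Φ j m k * g k)) := by
    refine tendsto_atTop_of_eventually_const (i₀ := m + 1) fun n hn => ?_
    refine (Finset.sum_subset (Finset.range_mono hn) fun k _ hk => ?_).symm
    rw [psiRow_of_lt (by simpa [Nat.lt_succ_iff] using hk), zero_mul]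
  refine forall₂_congr fun g _ => ⟨?_, ?_⟩
  · rintro ⟨h, ⟨a, ha⟩, hlim⟩
    exact ⟨a, ha.congr fun m => tendsto_nhds_unique (hlim m) (hrow m g)⟩
  · rintro ⟨a, ha⟩
    exact ⟨_, ⟨a, ha⟩, fun m => hrow m g⟩

/-- The first conjunct makes the limits defining `psi` exist and lets the limit in `m` pass through
the sum over `k`; only then is the second meaningful. -/
theorem mem_matrixClass_nablaDomain_iff {q γ : ℝ} (hq0 : 0 < q) (hq1 : q < 1) (hγ : 0 ≤ γ)
    (Φ : CMat) {p : ℝ≥0∞} [Fact (1 ≤ p)] (Y : Set CSeq) :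
    Φ ∈ matrixClass (nablaDomain q γ (ellSpace p)) Y ↔
      (∀ j, psiRow q γ Φ j ∈ matrixClass (ellSpace p) convSpace) ∧
        psi q γ Φ ∈ matrixClass (ellSpace p) Y := by
  rw [mem_matrixClass_nablaDomain hq0 hq1 hγ]
  have key (hT : ∀ j, psiRow q γ Φ j ∈ matrixClass (ellSpace p) convSpace) (g : CSeq)
      (hg : g ∈ ellSpace p) (j : ℕ) : ∃ a : ℂ,
      Tendsto (fun m => ∑ k ∈ Finset.range (m + 1), psiRow q γ Φ j m k * g k) atTop (𝓝 a) ∧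
        Tendsto (fun n => ∑ k ∈ Finset.range n, psi q γ Φ j k * g k) atTop (𝓝 a) := by
    have hl := tendsto_psiRow (colLimitsExist_of_mem_matrixClass (hT j))
    obtain ⟨C, hC⟩ := ((mem_matrixClass_iff convSpace_subset _).1 (hT j)).1
    refine ⟨∑' k, psi q γ Φ j k * g k, ?_, ?_⟩
    · simpa only [tsum_psiRow_mul] using! tendsto_tsum_of_mem_matrixClass_conv (hT j) hl ⟨g, hg⟩
    · exact ((RowBd.of_tendsto hC hl).summable ne_zero_of_one_le
        ⟨g, hg⟩).hasSum.tendsto_sum_nat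
  constructor
  · intro H
    have hT (j : ℕ) : psiRow q γ Φ j ∈ matrixClass (ellSpace p) convSpace := by
      rw [psiRow_mem_matrixClass_iff]
      intro g hg
      obtain ⟨y, -, hy⟩ := H g hg
      exact ⟨y j, hy j⟩
    refine ⟨hT, fun g hg => ?_⟩
    obtain ⟨y, hY, hy⟩ := H g hg
    refine ⟨y, hY, fun j => ?_⟩
    obtain ⟨a, h1, h2⟩ := key hT g hg j
    rwa [tendsto_nhds_unique (hy j) h1]
  · rintro ⟨hT, H⟩ g hg
    obtain ⟨y, hY, hy⟩ := H g hg
    refine ⟨y, hY, fun j => ?_⟩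
    obtain ⟨a, h1, h2⟩ := key hT g hg j
    rwa [tendsto_nhds_unique (hy j) h2]

/-! ### The conditions on triangles and limits as matrix classes -/

theorem sum_enorm_psiRow_rpow (q γ : ℝ) (Φ : CMat) (j m : ℕ) {s : ℝ} (hs : 0 < s) :
    ∑ k ∈ Finset.range (m + 1), ‖psiRow q γ Φ j m k‖ₑ ^ s = ∑' k, ‖psiRow q γ Φ j m k‖ₑ ^ s :=
  (tsum_eq_sum fun k hk => by
    rw [psiRow_of_lt (by simpa [Nat.lt_succ_iff] using hk), enorm_zero,
      ENNReal.zero_rpow_of_pos hs]).symm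

theorem trianglesOne_iff {q γ : ℝ} {Φ : CMat} :
    (∀ j, psiRow q γ Φ j ∈ matrixClass (ellSpace 1) convSpace) ↔ TrianglesOne q γ Φ :=
  forall_congr' fun j => by
    rw [mem_matrixClass_conv_iff ENNReal.one_ne_top, exists_rowBd_one_iff, EntriesBounded]

theorem trianglesPow_iff {q γ p s : ℝ} (hps : p.HolderConjugate s)
    [Fact (1 ≤ ENNReal.ofReal p)] {Φ : CMat} :
    (∀ j, psiRow q γ Φ j ∈ matrixClass (ellSpace (ENNReal.ofReal p)) convSpace) ↔
      TrianglesPow q γ s Φ :=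
  forall_congr' fun j => by
    rw [mem_matrixClass_conv_iff ENNReal.ofReal_ne_top, exists_rowBd_rpow_iff hps,
      PartialRowSumsBounded]
    simp only [sum_enorm_psiRow_rpow _ _ _ _ _ hps.symm.pos]

theorem tendsto_tsum_enorm_iff {A : CMat} (hA : ∀ j, Summable fun k => ‖A j k‖) {l : CSeq}
    (hl : Summable fun k => ‖l k‖) :
    Tendsto (fun j => ∑' k, ‖A j k‖ₑ) atTop (𝓝 (∑' k, ‖l k‖ₑ)) ↔
      Tendsto (fun j => ∑' k, ‖A j k‖) atTop (𝓝 (∑' k, ‖l k‖)) := by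
  simp only [tsum_enorm_eq_ofReal hl, fun j => tsum_enorm_eq_ofReal (hA j)]
  constructor
  · intro h
    have := (ENNReal.tendsto_toReal ENNReal.ofReal_ne_top).comp h
    simpa only [Function.comp_def, ENNReal.toReal_ofReal (tsum_nonneg fun _ => norm_nonneg _)]
      using this
  · exact fun h => ENNReal.tendsto_ofReal h

theorem summable_norm_psiRow (q γ : ℝ) (Φ : CMat) (j m : ℕ) :
    Summable fun k => ‖psiRow q γ Φ j m k‖ :=
  summable_of_ne_finset_zero (s := Finset.range (m + 1)) fun k hk => by
    rw [psiRow_of_lt (by simpa [Nat.lt_succ_iff] using hk), norm_zero]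

theorem trianglesInfty_iff {q γ : ℝ} {Φ : CMat} :
    (∀ j, psiRow q γ Φ j ∈ matrixClass (ellSpace ∞) convSpace) ↔ TrianglesInfty q γ Φ :=
  forall_congr' fun j => by
    have hs := summable_norm_psiRow q γ Φ j
    have he (m : ℕ) : ∑ k ∈ Finset.range (m + 1), ‖psiRow q γ Φ j m k‖ₑ =
        ∑' k, ‖psiRow q γ Φ j m k‖ₑ := by
      simpa using sum_enorm_psiRow_rpow q γ Φ j m one_pos
    rw [mem_matrixClass_top_conv_iff, PartialRowSumsTendTo]
    simp only [he]
    constructor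
    · rintro ⟨-, l, hl, hcol, h⟩
      have hc : ColLimitsExist (psiRow q γ Φ j) := fun k => ⟨l k, hcol k⟩
      obtain rfl : l = psi q γ Φ j :=
        funext fun k => tendsto_nhds_unique (hcol k) (tendsto_psiRow hc k)
      exact ⟨hc, summable_norm_iff_tsum_enorm_lt_top.1 hl, (tendsto_tsum_enorm_iff hs hl).2 h⟩
    · rintro ⟨hc, hlt, h⟩
      have hl := summable_norm_iff_tsum_enorm_lt_top.2 hlt
      exact ⟨hs, _, hl, tendsto_psiRow hc, (tendsto_tsum_enorm_iff hs hl).1 h⟩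

theorem TrianglesInfty.summable_norm_psi {q γ : ℝ} {Φ : CMat} (h : TrianglesInfty q γ Φ) (j : ℕ) :
    Summable fun k => ‖psi q γ Φ j k‖ :=
  summable_norm_iff_tsum_enorm_lt_top.2 (h j).2.1

/-- Summability is assumed because sums in `[0, ∞]` can tend to `0` with finitely many of them
infinite. The finiteness in `TrianglesInfty` supplies it for `psi`. -/
theorem mem_matrixClass_top_null_iff_rowSums {A : CMat} (hA : ∀ j, Summable fun k => ‖A j k‖) :
    A ∈ matrixClass (ellSpace ∞) nullSpace ↔ RowSumsTendToZero A := by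
  rw [mem_matrixClass_top_null_iff, and_iff_right hA, RowSumsTendToZero]
  have h0 : Summable fun k => ‖(0 : CSeq) k‖ := by simp
  simpa using (tendsto_tsum_enorm_iff hA h0).symm

theorem mem_matrixClass_top_conv_iff_rowSums {A : CMat} (hA : ∀ j, Summable fun k => ‖A j k‖) :
    A ∈ matrixClass (ellSpace ∞) convSpace ↔ ColLimitsExist A ∧ RowSumsTendToSumOfLimits A := by
  rw [mem_matrixClass_top_conv_iff, and_iff_right hA, RowSumsTendToSumOfLimits]
  constructor
  · rintro ⟨l, hl, hcol, h⟩
    have hlim : (fun k => limUnder atTop fun j => A j k) = l :=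
      funext fun k => (hcol k).limUnder_eq
    refine ⟨fun k => ⟨l k, hcol k⟩, ?_⟩
    simp only [fun k => (hcol k).limUnder_eq]
    exact ⟨summable_norm_iff_tsum_enorm_lt_top.1 hl, (tendsto_tsum_enorm_iff hA hl).2 h⟩
  · rintro ⟨hc, hlt, h⟩
    have hl := summable_norm_iff_tsum_enorm_lt_top.2 hlt
    exact ⟨_, hl, fun k => tendsto_nhds_limUnder (hc k), (tendsto_tsum_enorm_iff hA hl).1 h⟩

theorem mainTheorem9 (q γ p : ℝ) (hq0 : 0 < q) (hq1 : q < 1) (hγ : 0 ≤ γ) (hp : 1 < p)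
    (Φ : CMat) :
    -- from `ℓ_1(∇_q^{(γ)})` to `ℓ_1`, `c_0`, `c`, `ℓ_∞`
    ((Φ ∈ matrixClass (nablaDomain q γ (ellSpace 1)) (ellSpace 1) ↔
        TrianglesOne q γ Φ ∧ FiniteSumsBounded (psi q γ Φ)) ∧
      (Φ ∈ matrixClass (nablaDomain q γ (ellSpace 1)) nullSpace ↔
        TrianglesOne q γ Φ ∧ ColLimitsZero (psi q γ Φ) ∧ EntriesBounded (psi q γ Φ)) ∧
      (Φ ∈ matrixClass (nablaDomain q γ (ellSpace 1)) convSpace ↔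
        TrianglesOne q γ Φ ∧ ColLimitsExist (psi q γ Φ) ∧ EntriesBounded (psi q γ Φ)) ∧
      (Φ ∈ matrixClass (nablaDomain q γ (ellSpace 1)) (ellSpace ∞) ↔
        TrianglesOne q γ Φ ∧ EntriesBounded (psi q γ Φ))) ∧
    -- from `ℓ_p(∇_q^{(γ)})` to `ℓ_1`, `c_0`, `c`, `ℓ_∞`, with `p' = p / (p - 1)`
    ((Φ ∈ matrixClass (nablaDomain q γ (ellSpace (ENNReal.ofReal p))) (ellSpace 1) ↔
        TrianglesPow q γ (p / (p - 1)) Φ ∧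
          FiniteSumsRowBounded (p / (p - 1)) (psi q γ Φ)) ∧
      (Φ ∈ matrixClass (nablaDomain q γ (ellSpace (ENNReal.ofReal p))) nullSpace ↔
        TrianglesPow q γ (p / (p - 1)) Φ ∧ ColLimitsZero (psi q γ Φ) ∧
          RowSumsBounded (p / (p - 1)) (psi q γ Φ)) ∧
      (Φ ∈ matrixClass (nablaDomain q γ (ellSpace (ENNReal.ofReal p))) convSpace ↔
        TrianglesPow q γ (p / (p - 1)) Φ ∧ ColLimitsExist (psi q γ Φ) ∧
          RowSumsBounded (p / (p - 1)) (psi q γ Φ)) ∧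
      (Φ ∈ matrixClass (nablaDomain q γ (ellSpace (ENNReal.ofReal p))) (ellSpace ∞) ↔
        TrianglesPow q γ (p / (p - 1)) Φ ∧
          RowSumsBounded (p / (p - 1)) (psi q γ Φ))) ∧
    -- from `ℓ_∞(∇_q^{(γ)})` to `ℓ_1`, `c_0`, `c`, `ℓ_∞`
    ((Φ ∈ matrixClass (nablaDomain q γ (ellSpace ∞)) (ellSpace 1) ↔
        TrianglesInfty q γ Φ ∧ FiniteSumsRowBounded 1 (psi q γ Φ)) ∧
      (Φ ∈ matrixClass (nablaDomain q γ (ellSpace ∞)) nullSpace ↔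
        TrianglesInfty q γ Φ ∧ RowSumsTendToZero (psi q γ Φ)) ∧
      (Φ ∈ matrixClass (nablaDomain q γ (ellSpace ∞)) convSpace ↔
        TrianglesInfty q γ Φ ∧ ColLimitsExist (psi q γ Φ) ∧
          RowSumsTendToSumOfLimits (psi q γ Φ)) ∧
      (Φ ∈ matrixClass (nablaDomain q γ (ellSpace ∞)) (ellSpace ∞) ↔
        TrianglesInfty q γ Φ ∧ RowSumsBounded 1 (psi q γ Φ))) := by
  have hps : p.HolderConjugate (p / (p - 1)) := Real.HolderConjugate.conjExponent hp
  have hp1 : Fact (1 ≤ ENNReal.ofReal p) := ⟨ENNReal.one_le_ofReal.2 hp.le⟩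
  have hpt : ENNReal.ofReal p ≠ ∞ := ENNReal.ofReal_ne_top
  simp only [mem_matrixClass_nablaDomain_iff hq0 hq1 hγ, trianglesOne_iff, trianglesPow_iff hps,
    trianglesInfty_iff]
  refine ⟨⟨?_, ?_, ?_, ?_⟩, ⟨?_, ?_, ?_, ?_⟩, ⟨?_, ?_, ?_, ?_⟩⟩
  · rw [mem_matrixClass_one_iff, exists_rowBd_one_iff, FiniteSumsBounded]
  · rw [mem_matrixClass_null_iff ENNReal.one_ne_top, exists_rowBd_one_iff, EntriesBounded]
  · rw [mem_matrixClass_conv_iff ENNReal.one_ne_top, exists_rowBd_one_iff, EntriesBounded]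
  · rw [mem_matrixClass_top_iff, exists_rowBd_one_iff, EntriesBounded]
  · rw [mem_matrixClass_one_iff, exists_rowBd_rpow_iff hps, FiniteSumsRowBounded]
  · rw [mem_matrixClass_null_iff hpt, exists_rowBd_rpow_iff hps, RowSumsBounded]
  · rw [mem_matrixClass_conv_iff hpt, exists_rowBd_rpow_iff hps, RowSumsBounded]
  · rw [mem_matrixClass_top_iff, exists_rowBd_rpow_iff hps, RowSumsBounded]
  · rw [mem_matrixClass_one_iff, exists_rowBd_top_iff, FiniteSumsRowBounded]
  · exact and_congr_right fun h => mem_matrixClass_top_null_iff_rowSums h.summable_norm_psi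
  · exact and_congr_right fun h => mem_matrixClass_top_conv_iff_rowSums h.summable_norm_psi
  · rw [mem_matrixClass_top_iff, exists_rowBd_top_iff, RowSumsBounded]
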